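/- Let $G$ be a (simple, not necessarily connected) graph of finite maximum degree, and let $\varepsilon$ be a thick end of $G$. Then $G$ has a diverging double ray all of whose tails lie in $\varepsilon$. Here a ray is a one-way infinite path, a double ray is a two-way infinite path, and a tail of a (double) ray is any ray contained in it. An end of $G$ is an equivalence class of rays, where two rays are equivalent if they are joined by infinitely many pairwise disjoint paths in $G$; it is thick if for every $n\in\mathbb N$ it contains $n$ pairwise disjoint rays. Two rays $R,S$ diverge if for every $n\in\mathbb N$ they have tails $R'\subseteq R$ and $S'\subseteq S$ with $d_G(R',S')>n$, where $d_G(R',S')$ is the minimum distance in $G$ between a vertex of $R'$ and a vertex of $S'$. A double ray diverges if every two disjoint tails of it diverge. -/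

import Mathlib

namespace SimpleGraph

universe u

variable {V : Type u} {G : SimpleGraph V}

/-- A ray: a one-way infinite path, with its vertices listed from the first one on. -/
structure Ray (G : SimpleGraph V) where
  vert : ℕ → V
  inj : Function.Injective vert
  adj : ∀ n, G.Adj (vert n) (vert (n + 1))

/-- A double ray: a two-way infinite path. -/
structure DoubleRay (G : SimpleGraph V) where
  vert : ℤ → V
  inj : Function.Injective vert
  adj : ∀ n, G.Adj (vert n) (vert (n + 1))

namespace Ray

/-- The vertex set of a ray. -/
def verts (R : G.Ray) : Set V := Set.range R.vert

/-- `T` is a tail (subray) of the ray `R`. -/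
def IsTail (T R : G.Ray) : Prop := ∃ k : ℕ, ∀ n, T.vert n = R.vert (k + n)

/-- Two rays are equivalent if they are joined by infinitely many pairwise disjoint paths
(a path may be trivial, where the rays meet). -/
def Equivalent (R S : G.Ray) : Prop :=
  ∃ (a b : ℕ → V) (p : ∀ n, G.Walk (a n) (b n)),
    (∀ n, a n ∈ R.verts ∧ b n ∈ S.verts ∧ (p n).IsPath) ∧
    ∀ m n, m ≠ n → (p m).support.Disjoint (p n).support

/-- Any two vertices of a ray are joined by a walk that stays on the ray, beyond any index that
bounds both from below. -/
theorem exists_walk (R : G.Ray) (N i j : ℕ) (hi : N ≤ i) (hj : N ≤ j) :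
    ∃ p : G.Walk (R.vert i) (R.vert j), ∀ v ∈ p.support, ∃ k, N ≤ k ∧ v = R.vert k := by
  have key : ∀ d i, N ≤ i → ∃ p : G.Walk (R.vert i) (R.vert (i + d)),
      ∀ v ∈ p.support, ∃ k, N ≤ k ∧ v = R.vert k := by
    intro d
    induction d with
    | zero => intro i hi; exact ⟨.nil, by simpa using ⟨i, hi, rfl⟩⟩
    | succ d ih =>
      intro i hi
      obtain ⟨p, hp⟩ := ih i hi
      refine ⟨p.append (Walk.cons (R.adj (i + d)) Walk.nil), ?_⟩
      intro v hv
      rw [Walk.mem_support_append_iff] at hv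
      rcases hv with hv | hv
      · exact hp v hv
      · simp only [Walk.support_cons, Walk.support_nil, List.mem_cons, List.not_mem_nil,
          or_false] at hv
        rcases hv with rfl | rfl
        · exact ⟨i + d, by omega, rfl⟩
        · exact ⟨i + d + 1, by omega, rfl⟩
  rcases le_total i j with h | h
  · obtain ⟨d, rfl⟩ := Nat.exists_eq_add_of_le h
    exact key d i hi
  · obtain ⟨d, rfl⟩ := Nat.exists_eq_add_of_le h
    obtain ⟨p, hp⟩ := key d j hj
    exact ⟨p.reverse, by simpa using hp⟩

theorem exists_avoids (R : G.Ray) (U : Finset V) : ∃ N, ∀ k, N ≤ k → R.vert k ∉ U := by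
  have h : (R.vert ⁻¹' (U : Set V)).Finite := U.finite_toSet.preimage R.inj.injOn
  obtain ⟨N, hN⟩ := h.bddAbove
  exact ⟨N + 1, fun k hk hkU => by have := hN (show k ∈ R.vert ⁻¹' (U : Set V) from hkU); omega⟩

/-- Two rays are equivalent if and only if, for every finite set `U` of vertices, they have tails
in the same component of the graph minus `U`. -/
theorem equivalent_iff (R S : G.Ray) : R.Equivalent S ↔
    ∀ U : Finset V, ∃ N, ∀ i j, N ≤ i → N ≤ j →
      ∃ p : G.Walk (R.vert i) (S.vert j), ∀ v ∈ p.support, v ∉ U := by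
  classical
  constructor
  · rintro ⟨a, b, p, hp, hd⟩ U
    obtain ⟨N, hN⟩ := R.exists_avoids U
    obtain ⟨M, hM⟩ := S.exists_avoids U
    set W : Finset V := U ∪ (Finset.range N).image R.vert ∪ (Finset.range M).image S.vert with hW
    obtain ⟨n, hn⟩ : ∃ n, ∀ v ∈ (p n).support, v ∉ W := by
      by_contra! hcon
      choose f hf hfW using hcon
      have hinj : Function.Injective f := by
        intro m n hmn
        by_contra hne
        exact hd m n hne (hf m) (hmn ▸ hf n)
      exact (Set.infinite_range_of_injective hinj)
        (W.finite_toSet.subset (by rintro _ ⟨n, rfl⟩; exact hfW n))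
    obtain ⟨⟨i₀, hi₀⟩, ⟨j₀, hj₀⟩, -⟩ := hp n
    have hiN : N ≤ i₀ := by
      by_contra hlt
      refine hn _ (p n).start_mem_support ?_
      rw [← hi₀, hW]
      simp only [Finset.mem_union, Finset.mem_image, Finset.mem_range]
      exact Or.inl (Or.inr ⟨i₀, by omega, rfl⟩)
    have hjM : M ≤ j₀ := by
      by_contra hlt
      refine hn _ (p n).end_mem_support ?_
      rw [← hj₀, hW]
      simp only [Finset.mem_union, Finset.mem_image, Finset.mem_range]
      exact Or.inr ⟨j₀, by omega, rfl⟩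
    refine ⟨max N M, fun i j hi hj => ?_⟩
    obtain ⟨q, hq⟩ := R.exists_walk N i i₀ (by omega) hiN
    obtain ⟨r, hr⟩ := S.exists_walk M j₀ j hjM (by omega)
    refine ⟨(q.append ((p n).copy hi₀.symm hj₀.symm)).append r, fun v hv => ?_⟩
    rw [Walk.mem_support_append_iff, Walk.mem_support_append_iff, Walk.support_copy] at hv
    rcases hv with (hv | hv) | hv
    · obtain ⟨k, hk, rfl⟩ := hq v hv
      exact hN k hk
    · exact fun hU => hn v hv (by rw [hW]; simp [hU])
    · obtain ⟨k, hk, rfl⟩ := hr v hv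
      exact hM k hk
  · intro h
    obtain ⟨f, hf, hdis⟩ := exists_seq_of_forall_finset_exists
      (α := Σ a b : V, G.Walk a b)
      (fun x => x.1 ∈ R.verts ∧ x.2.1 ∈ S.verts ∧ x.2.2.IsPath)
      (fun x y => x.2.2.support.Disjoint y.2.2.support) (by
        intro s _
        obtain ⟨N, hN⟩ := h (s.biUnion fun x => x.2.2.support.toFinset)
        obtain ⟨p, hp⟩ := hN N N le_rfl le_rfl
        refine ⟨⟨_, _, p.bypass⟩, ⟨⟨N, rfl⟩, ⟨N, rfl⟩, p.bypass_isPath⟩, ?_⟩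
        intro x hx v hvx hv
        refine hp v (p.support_bypass_subset_support hv) ?_
        simp only [Finset.mem_biUnion, List.mem_toFinset]
        exact ⟨x, hx, hvx⟩)
    refine ⟨fun n => (f n).1, fun n => (f n).2.1, fun n => (f n).2.2, hf, fun m n hmn => ?_⟩
    rcases lt_or_gt_of_ne hmn with hlt | hlt
    · exact hdis m n hlt
    · exact (hdis n m hlt).symm

theorem equivalent_equivalence (G : SimpleGraph V) : Equivalence (Equivalent (G := G)) where
  refl R := (equivalent_iff R R).2 fun U => by
    obtain ⟨N, hN⟩ := R.exists_avoids U
    refine ⟨N, fun i j hi hj => ?_⟩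
    obtain ⟨p, hp⟩ := R.exists_walk N i j hi hj
    refine ⟨p, fun v hv => ?_⟩
    obtain ⟨k, hk, rfl⟩ := hp v hv
    exact hN k hk
  symm {R S} h := (equivalent_iff S R).2 fun U => by
    obtain ⟨N, hN⟩ := (equivalent_iff R S).1 h U
    refine ⟨N, fun i j hi hj => ?_⟩
    obtain ⟨p, hp⟩ := hN j i hj hi
    exact ⟨p.reverse, by simpa using hp⟩
  trans {R S T} h h' := (equivalent_iff R T).2 fun U => by
    obtain ⟨N, hN⟩ := (equivalent_iff R S).1 h U
    obtain ⟨M, hM⟩ := (equivalent_iff S T).1 h' U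
    refine ⟨max N M, fun i j hi hj => ?_⟩
    obtain ⟨p, hp⟩ := hN i (max N M) (by omega) (by omega)
    obtain ⟨q, hq⟩ := hM (max N M) j (by omega) (by omega)
    refine ⟨p.append q, fun v hv => ?_⟩
    rw [Walk.mem_support_append_iff] at hv
    exact hv.elim (hp v) (hq v)

/-- The equivalence of rays, as a setoid. -/
def setoid (G : SimpleGraph V) : Setoid G.Ray := ⟨Equivalent, equivalent_equivalence G⟩

end Ray

/-- The ends of a graph: the equivalence classes of its rays. -/
def RayEnd (G : SimpleGraph V) : Type u := Quotient (Ray.setoid G)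

/-- The end that contains a given ray. -/
def Ray.toEnd (R : G.Ray) : G.RayEnd := Quotient.mk (Ray.setoid G) R

/-- An end is thick if, for every `n`, it contains `n` pairwise disjoint rays. -/
def RayEnd.IsThick (ε : G.RayEnd) : Prop :=
  ∀ n : ℕ, ∃ R : Fin n → G.Ray,
    (∀ i, (R i).toEnd = ε) ∧ ∀ i j, i ≠ j → Disjoint (R i).verts (R j).verts

/-- The distance between two sets of vertices (`⊤` if no path joins them). -/
noncomputable def setEDist (G : SimpleGraph V) (U W : Set V) : ℕ∞ :=
  ⨅ u ∈ U, ⨅ w ∈ W, G.edist u w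

/-- Two rays diverge if, for every `n`, they have tails at distance more than `n`. -/
def Ray.Diverge (R S : G.Ray) : Prop :=
  ∀ n : ℕ, ∃ R' S' : G.Ray, R'.IsTail R ∧ S'.IsTail S ∧ (n : ℕ∞) < G.setEDist R'.verts S'.verts

/-- `T` is a tail (subray) of the double ray `D`, in one of its two directions. -/
def Ray.IsTailOfDouble (T : G.Ray) (D : G.DoubleRay) : Prop :=
  (∃ k : ℤ, ∀ n : ℕ, T.vert n = D.vert (k + n)) ∨ (∃ k : ℤ, ∀ n : ℕ, T.vert n = D.vert (k - n))

/-- All tails of the double ray `D` lie in the end `ε`. -/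
def DoubleRay.LiesIn (D : G.DoubleRay) (ε : G.RayEnd) : Prop :=
  ∀ T : G.Ray, T.IsTailOfDouble D → T.toEnd = ε

/-- A double ray diverges if every two disjoint tails of it diverge. -/
def DoubleRay.Diverges (D : G.DoubleRay) : Prop :=
  ∀ T T' : G.Ray, T.IsTailOfDouble D → T'.IsTailOfDouble D → Disjoint T.verts T'.verts →
    T.Diverge T'

end SimpleGraph

/-! Divergence in `G` is turned into bounded separation in another graph. Fix `o` in the component
that carries the end and a slowly growing, unbounded, monotone `f`. In the power graph `H` on this
component, two vertices are adjacent when their `G`-distance is at most the larger value of `f` at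
their distances from `o`. If two sets have `H`-distance more than 3, then rays of `G` that stay
within one `H`-step of them are, at a vertex `x` of the first ray, more than `f (dist o x)` apart,
so they diverge.

Thickness enters only through `exists_powerGraph_escape`. An `H`-ball of radius `N` lies in a
`G`-ball of radius `N * n`, where `n` is a value of `f`, and so has at most `(Δ + 1) ^ (N * n)`
vertices. Among one more than that many disjoint rays of the end, some ray misses the ball. If `f`
grows slowly enough, these rays also start closer to `o` than the ball, so the ball does not
separate `o` from the end.

The core, `exists_far_connected_sets`, is a coarse Menger argument for two paths in `H`. Let `R` be
an `H`-geodesic ray towards the end. If some connected set at distance more than 3 from `R` comes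
near `R` arbitrarily far out, then this set and `R` are as required. Otherwise every component of
the vertices at distance more than 10 from `R` is attached to a bounded part of `R`, and since balls
do not separate, such components jump over every late vertex of `R`. A greedy choice yields a chain
of overlapping jumps (`JumpChain`). Close successive components are linked into runs, and runs are
divided by breaks, of which there are infinitely many. The runs of even index, joined by pieces of
`R`, form one route and those of odd index the other (`JumpChain.exists_routes`).

Each route expands to a connected set of `G`, which contains a ray of the end
(`exists_ray_of_connectedOn`). A shortest path between the two rays completes a double ray
(`exists_doubleRay`). -/

namespace SimpleGraph

-- Walks inside vertex sets, and geodesic rays.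

universe u

variable {V : Type u} {K : SimpleGraph V}

/-- Two vertices are joined by a walk all of whose vertices lie in `S`. -/
def ReachableIn (K : SimpleGraph V) (S : Set V) (x y : V) : Prop :=
  ∃ p : K.Walk x y, ∀ v ∈ p.support, v ∈ S

/-- Any two vertices of `S` are joined by a walk inside `S`. -/
def ConnectedOn (K : SimpleGraph V) (S : Set V) : Prop :=
  ∀ x ∈ S, ∀ y ∈ S, K.ReachableIn S x y

namespace ReachableIn

variable {S T : Set V} {x y z : V}

theorem refl (h : x ∈ S) : K.ReachableIn S x x := ⟨.nil, by simpa using h⟩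

theorem symm (h : K.ReachableIn S x y) : K.ReachableIn S y x := by
  obtain ⟨p, hp⟩ := h
  exact ⟨p.reverse, by simpa using hp⟩

theorem trans (h : K.ReachableIn S x y) (h' : K.ReachableIn S y z) : K.ReachableIn S x z := by
  obtain ⟨p, hp⟩ := h
  obtain ⟨q, hq⟩ := h'
  refine ⟨p.append q, fun v hv => ?_⟩
  rw [Walk.mem_support_append_iff] at hv
  exact hv.elim (hp v) (hq v)

theorem mono (hST : S ⊆ T) (h : K.ReachableIn S x y) : K.ReachableIn T x y := by
  obtain ⟨p, hp⟩ := h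
  exact ⟨p, fun v hv => hST (hp v hv)⟩

theorem mem_left (h : K.ReachableIn S x y) : x ∈ S := by
  obtain ⟨p, hp⟩ := h
  exact hp _ p.start_mem_support

theorem mem_right (h : K.ReachableIn S x y) : y ∈ S := h.symm.mem_left

theorem of_adj (h : K.Adj x y) (hx : x ∈ S) (hy : y ∈ S) : K.ReachableIn S x y :=
  ⟨.cons h .nil, by simp [hx, hy]⟩

/-- Every vertex of a shortest walk splits the distance of its ends exactly, so only the metric
interval between `x` and `y` has to lie in `S`. -/
theorem of_dist_of_reachable (hxy : K.Reachable x y)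
    (h : ∀ v, K.Reachable x v → K.dist x v + K.dist v y = K.dist x y → v ∈ S) :
    K.ReachableIn S x y := by
  classical
  obtain ⟨p, hp⟩ := hxy.exists_walk_length_eq_dist
  refine ⟨p, fun v hv => h v (p.takeUntil v hv).reachable ?_⟩
  have h1 := dist_le (p.takeUntil v hv)
  have h2 := dist_le (p.dropUntil v hv)
  have h3 := congrArg Walk.length (p.take_spec hv)
  rw [Walk.length_append] at h3
  have h4 := (p.takeUntil v hv).reachable.dist_triangle_left y
  omega

theorem of_dist (hK : K.Connected)
    (h : ∀ v, K.dist x v + K.dist v y = K.dist x y → v ∈ S) : K.ReachableIn S x y :=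
  of_dist_of_reachable (hK x y) fun v _ => h v

/-- A property that is inherited along the edges inside `S` is inherited along walks inside `S`. -/
theorem induct {P : V → Prop} (hP : ∀ u v, u ∈ S → v ∈ S → K.Adj u v → P u → P v)
    (h : K.ReachableIn S x y) (hx : P x) : P y := by
  obtain ⟨p, hp⟩ := h
  induction p with
  | nil => exact hx
  | cons hadj p ih =>
    simp only [Walk.support_cons, List.mem_cons, forall_eq_or_imp] at hp
    exact ih (hP _ _ hp.1 (hp.2 _ p.start_mem_support) hadj hx) hp.2

theorem of_seq {f : ℕ → V} {a b : ℕ} (hab : a ≤ b)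
    (hadj : ∀ n, a ≤ n → n < b → K.Adj (f n) (f (n + 1)))
    (hS : ∀ n, a ≤ n → n ≤ b → f n ∈ S) : K.ReachableIn S (f a) (f b) := by
  induction b, hab using Nat.le_induction with
  | base => exact refl (hS a le_rfl le_rfl)
  | succ n hn ih =>
    exact (ih (fun k h1 h2 => hadj k h1 (by omega)) (fun k h1 h2 => hS k h1 (by omega))).trans
      (of_adj (hadj n hn (by omega)) (hS n hn (by omega)) (hS (n + 1) (by omega) le_rfl))

end ReachableIn

theorem ConnectedOn.union {S T : Set V} (hS : K.ConnectedOn S) (hT : K.ConnectedOn T) {x : V}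
    (hxS : x ∈ S) (hxT : x ∈ T) : K.ConnectedOn (S ∪ T) := by
  have key : ∀ y ∈ S ∪ T, K.ReachableIn (S ∪ T) x y := by
    rintro y (hy | hy)
    · exact (hS x hxS y hy).mono Set.subset_union_left
    · exact (hT x hxT y hy).mono Set.subset_union_right
  exact fun y hy z hz => (key y hy).symm.trans (key z hz)

theorem ConnectedOn.iUnion_seq {T : ℕ → Set V} (hT : ∀ n, K.ConnectedOn (T n))
    (hne : ∀ n, (T n ∩ T (n + 1)).Nonempty) : K.ConnectedOn (⋃ n, T n) := by
  have hsub : ∀ n, T n ⊆ ⋃ n, T n := fun n => Set.subset_iUnion T n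
  choose x hx using hne
  have key : ∀ n, ∀ y ∈ T n, K.ReachableIn (⋃ n, T n) (x 0) y := by
    intro n
    induction n with
    | zero => exact fun y hy => (hT 0 _ (hx 0).1 y hy).mono (hsub 0)
    | succ n ih =>
      exact fun y hy => (ih _ (hx n).1).trans ((hT (n + 1) _ (hx n).2 y hy).mono (hsub _))
  intro y hy z hz
  obtain ⟨n, hn⟩ := Set.mem_iUnion.1 hy
  obtain ⟨k, hk⟩ := Set.mem_iUnion.1 hz
  exact (key n y hn).symm.trans (key k z hk)

theorem finite_dist_le (hK : K.Connected) (hfin : ∀ v, (K.neighborSet v).Finite) (o : V) (n : ℕ) :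
    {v | K.dist o v ≤ n}.Finite := by
  induction n with
  | zero =>
    refine (Set.finite_singleton o).subset fun v hv => ?_
    have : K.dist o v = 0 := by simpa using hv
    exact (hK.dist_eq_zero_iff.1 this).symm
  | succ n ih =>
    refine (ih.union (ih.biUnion fun v _ => hfin v)).subset fun v hv => ?_
    obtain ⟨p, hp⟩ := hK.exists_walk_length_eq_dist v o
    rw [dist_comm] at hp
    cases p with
    | nil => exact Or.inl (by simp)
    | @cons _ w _ h q =>
      right
      have h1 := dist_le q.reverse
      simp only [Walk.length_cons, Walk.length_reverse, Set.mem_ofPred_eq] at hp hv h1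
      exact Set.mem_biUnion (x := w) (show K.dist o w ≤ n by omega) h.symm

/-- In a connected locally finite graph every infinite set of vertices is approached by a
geodesic ray. -/
theorem exists_geodesic_ray (hK : K.Connected) (hfin : ∀ v, (K.neighborSet v).Finite) (o : V)
    {X : Set V} (hX : X.Infinite) :
    ∃ Y : ℕ → V, Y 0 = o ∧ (∀ n, K.Adj (Y n) (Y (n + 1))) ∧ (∀ n, K.dist o (Y n) = n) ∧
      ∀ n, {x ∈ X | K.dist o x = n + K.dist (Y n) x}.Infinite := by
  -- König's argument: `A y` collects the points of `X` that have a shortest path from `o` through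
  -- `y`. An infinite `A y` is covered, up to `y` itself, by the corresponding sets of its finitely
  -- many neighbours.
  let A : V → Set V := fun y => {x ∈ X | K.dist o x = K.dist o y + K.dist y x}
  have step : ∀ y, (A y).Infinite →
      ∃ y', K.Adj y y' ∧ K.dist o y' = K.dist o y + 1 ∧ (A y').Infinite := by
    intro y hy
    have hcov : A y \ {y} ⊆ ⋃ w ∈ K.neighborSet y, {x ∈ A y | K.dist y x = 1 + K.dist w x} := by
      rintro x ⟨hx, hxy⟩
      obtain ⟨p, hp⟩ := hK.exists_walk_length_eq_dist y x
      cases p with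
      | nil => exact absurd rfl hxy
      | @cons _ w _ h q =>
        refine Set.mem_biUnion (x := w) h ⟨hx, ?_⟩
        have h1 := dist_le q
        have h2 : K.dist y x ≤ K.dist y w + K.dist w x := hK.dist_triangle
        have h3 := dist_eq_one_iff_adj.2 h
        rw [Walk.length_cons] at hp
        omega
    have hinf : ∃ w ∈ K.neighborSet y, {x ∈ A y | K.dist y x = 1 + K.dist w x}.Infinite := by
      by_contra! hcon
      exact (hy.sdiff (Set.finite_singleton y))
        (((hfin y).biUnion fun w hw => hcon w hw).subset hcov)
    obtain ⟨w, hw, hwinf⟩ := hinf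
    have hw1 := dist_eq_one_iff_adj.2 hw
    have hdist : K.dist o w = K.dist o y + 1 := by
      obtain ⟨x, ⟨-, hx⟩, hx'⟩ := hwinf.nonempty
      have h2 : K.dist o x ≤ K.dist o w + K.dist w x := hK.dist_triangle
      have h3 : K.dist o w ≤ K.dist o y + K.dist y w := hK.dist_triangle
      omega
    refine ⟨w, hw, hdist, hwinf.mono ?_⟩
    rintro x ⟨⟨hxX, hx⟩, hx'⟩
    exact ⟨hxX, by omega⟩
  have h0 : (A o).Infinite := by
    have : A o = X := by ext x; simp [A]
    rwa [this]
  choose! g hg1 hg2 hg3 using step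
  let Y : ℕ → V := fun n => g^[n] o
  have hY : ∀ n, Y (n + 1) = g (Y n) := fun n => Function.iterate_succ_apply' g n o
  have hinf : ∀ n, (A (Y n)).Infinite := by
    intro n
    induction n with
    | zero => exact h0
    | succ n ih => rw [hY]; exact hg3 _ ih
  have hd : ∀ n, K.dist o (Y n) = n := by
    intro n
    induction n with
    | zero => simp [Y]
    | succ n ih => rw [hY, hg2 _ (hinf n), ih]
  refine ⟨Y, rfl, fun n => by rw [hY]; exact hg1 _ (hinf n), hd, fun n => ?_⟩
  have := hinf n
  simp only [A, hd] at this
  exact this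

theorem dist_geodesic (hK : K.Connected) {Y : ℕ → V} (hadj : ∀ n, K.Adj (Y n) (Y (n + 1)))
    (hd : ∀ n, K.dist (Y 0) (Y n) = n) {i j : ℕ} (hij : i ≤ j) : K.dist (Y i) (Y j) = j - i := by
  have h1 : K.dist (Y 0) (Y j) ≤ K.dist (Y 0) (Y i) + K.dist (Y i) (Y j) := hK.dist_triangle
  rw [hd, hd] at h1
  have h2 : K.dist (Y i) (Y j) ≤ j - i := by
    clear h1
    induction j, hij using Nat.le_induction with
    | base => simp
    | succ n hn ih =>
      have h3 : K.dist (Y i) (Y (n + 1)) ≤ K.dist (Y i) (Y n) + K.dist (Y n) (Y (n + 1)) :=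
        hK.dist_triangle
      rw [dist_eq_one_iff_adj.2 (hadj n)] at h3
      omega
  omega

end SimpleGraph

/-! ### Components far from a geodesic ray, and chains of jumps. -/

namespace SimpleGraph

universe u

variable {V : Type u}

/-- `E` is a component of the subgraph of `K` induced by `U`. -/
structure IsComponentOf (K : SimpleGraph V) (U E : Set V) : Prop where
  subset : E ⊆ U
  connectedOn : K.ConnectedOn E
  closed : ∀ x ∈ E, ∀ y ∈ U, K.Adj x y → y ∈ E

theorem IsComponentOf.subset_of_mem {K : SimpleGraph V} {U E F : Set V}
    (hE : K.IsComponentOf U E) (hF : K.IsComponentOf U F) {w : V} (hwE : w ∈ E) (hwF : w ∈ F) :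
    E ⊆ F := fun x hx =>
  (hE.connectedOn w hwE x hx).induct (P := fun v => v ∈ F)
    (fun u v _ hv h hu => hF.closed u hu v (hE.subset hv) h) hwF

/-- The vertices at distance more than `m` from the sequence `R`. -/
def farSet (H : SimpleGraph V) (R : ℕ → V) (m : ℕ) : Set V := {v | ∀ z, m < H.dist v (R z)}

/-- The index `z` is an attachment of `E` if `E` has a vertex at distance at most `11` from `R z`. -/
def Attached (H : SimpleGraph V) (R : ℕ → V) (E : Set V) (z : ℕ) : Prop :=
  ∃ x ∈ E, H.dist x (R z) ≤ 11

/-- A vertex of a component close to a vertex outside it is close to an attachment. -/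
theorem IsComponentOf.exists_attached {H : SimpleGraph V} (hH : H.Connected) {R : ℕ → V}
    {E : Set V} (hE : H.IsComponentOf (H.farSet R 10) E) {x y : V} (hx : x ∈ E) (hy : y ∉ E) :
    ∃ z, H.Attached R E z ∧ H.dist x (R z) ≤ H.dist x y + 10 := by
  obtain ⟨p, hp⟩ := hH.exists_walk_length_eq_dist x y
  rw [← hp]
  clear hp
  induction p with
  | nil => exact absurd hx hy
  | @cons x w y h q ih =>
    have hxw := dist_eq_one_iff_adj.2 h
    rw [Walk.length_cons]
    by_cases hw : w ∈ E
    · obtain ⟨z, hz, hd⟩ := ih hw hy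
      have h2 : H.dist x (R z) ≤ H.dist x w + H.dist w (R z) := hH.dist_triangle
      exact ⟨z, hz, by omega⟩
    -- The walk leaves `E` at `w`, which by closedness is within 10 of some `R z`. Its predecessor
    -- in `E` is then within 11, whence the constant in `Attached`.
    · have hwU : w ∉ H.farSet R 10 := fun hwU => hw (hE.closed x hx w hwU h)
      obtain ⟨z, hz⟩ : ∃ z, H.dist w (R z) ≤ 10 := by
        simpa [farSet] using hwU
      have h2 : H.dist x (R z) ≤ H.dist x w + H.dist w (R z) := hH.dist_triangle
      exact ⟨z, ⟨x, hx, by omega⟩, by omega⟩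

/-- A sequence of components of the vertices far from `R`, the `k`th one jumping over the indices
from `a k` to `b k`, so that consecutive ones overlap or are close to each other. -/
structure JumpChain (H : SimpleGraph V) (R : ℕ → V) where
  E : ℕ → Set V
  a : ℕ → ℕ
  b : ℕ → ℕ
  δ : ℕ → ℕ
  isComponent : ∀ k, H.IsComponentOf (H.farSet R 10) (E k)
  attached_a : ∀ k, H.Attached R (E k) (a k)
  attached_b : ∀ k, H.Attached R (E k) (b k)
  le_of_attached : ∀ k z, H.Attached R (E k) z → a k ≤ z ∧ z ≤ b k
  a_succ : ∀ k, a k + 200 ≤ a (k + 1)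
  b_succ : ∀ k, b k + 200 ≤ b (k + 1)
  b_le_a : ∀ k, b k + 200 ≤ a (k + 3)
  -- Links have length at most 6 in general. Length 12 is allowed only where a component has been
  -- dropped, and then the intervals of the components `k` and `k + 2` are disjoint with a margin.
  δ_le : ∀ k, δ k ≤ 12
  sep_two : ∀ k, b k + 200 ≤ a (k + 2) ∨
    (∀ x ∈ E k, ∀ y ∈ E (k + 2), 12 < H.dist x y) ∧ δ k ≤ 6 ∧ δ (k + 1) ≤ 6
  break_or_link : ∀ k,
    ((∀ x ∈ E k, ∀ y ∈ E (k + 1), 6 < H.dist x y) ∧ a (k + 1) + 200 ≤ b k) ∨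
    ∃ x ∈ E k, ∃ y ∈ E (k + 1), H.dist x y ≤ δ k

namespace JumpChain

variable {H : SimpleGraph V} {R : ℕ → V} (C : JumpChain H R)

/-- The two routes may swap roles between the `k`th and the next component. -/
def IsBreak (k : ℕ) : Prop :=
  (∀ x ∈ C.E k, ∀ y ∈ C.E (k + 1), 6 < H.dist x y) ∧ C.a (k + 1) + 200 ≤ C.b k

/-- The vertices on short paths between the `k`th and the next component. -/
def link (k : ℕ) : Set V :=
  {u | ∃ x ∈ C.E k, ∃ y ∈ C.E (k + 1), H.dist x u + H.dist u y ≤ C.δ k}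

/-- The vertices on short paths between the `k`th component and `R z`. -/
def conn (k z : ℕ) : Set V := {u | ∃ e ∈ C.E k, H.dist (R z) u + H.dist u e ≤ 11}

/-- The components from the `f`th to the `g`th with their links, and with paths to the first and
last attachment. -/
def run (f g : ℕ) : Set V :=
  {u | (∃ k, f ≤ k ∧ k ≤ g ∧ u ∈ C.E k) ∨ (∃ k, f ≤ k ∧ k < g ∧ u ∈ C.link k) ∨
    u ∈ C.conn f (C.a f) ∨ u ∈ C.conn g (C.b g)}

/-- A rough location of a vertex along `R`. -/
def Located (p q : ℕ) (u : V) : Prop :=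
  (∃ k, p ≤ C.a k ∧ C.b k ≤ q ∧ u ∈ C.E k) ∨ ∃ z, p ≤ z ∧ z ≤ q ∧ H.dist u (R z) ≤ 34

theorem a_le_b (k : ℕ) : C.a k ≤ C.b k := (C.le_of_attached k _ (C.attached_a k)).2

theorem a_mono {i j : ℕ} (h : i ≤ j) : C.a i ≤ C.a j :=
  monotone_nat_of_le_succ (fun n => by have := C.a_succ n; omega) h

theorem b_mono {i j : ℕ} (h : i ≤ j) : C.b i ≤ C.b j :=
  monotone_nat_of_le_succ (fun n => by have := C.b_succ n; omega) h

theorem a_lt {i j : ℕ} (h : i < j) : C.a i + 200 ≤ C.a j :=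
  (C.a_succ i).trans (C.a_mono h)

theorem b_lt {i j : ℕ} (h : i < j) : C.b i + 200 ≤ C.b j :=
  (C.b_succ i).trans (C.b_mono h)

theorem b_lt_a {i j : ℕ} (h : i + 3 ≤ j) : C.b i + 200 ≤ C.a j :=
  (C.b_le_a i).trans (C.a_mono h)

theorem far_of_mem {k : ℕ} {u : V} (hu : u ∈ C.E k) (z : ℕ) : 10 < H.dist u (R z) :=
  (C.isComponent k).subset hu z

theorem notMem_E (k z : ℕ) : R z ∉ C.E k := fun h => by
  have := C.far_of_mem h z
  simp at this

/-- A common vertex would put `E l` inside `E k`, making `b l` an attachment of `E k` beyond its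
last one. -/
theorem notMem_of_lt {k l : ℕ} (h : C.b k < C.b l) {w : V} (hw : w ∈ C.E k) : w ∉ C.E l := by
  intro hw'
  obtain ⟨x, hx, hd⟩ := C.attached_b l
  have := (C.le_of_attached k _
    ⟨x, (C.isComponent l).subset_of_mem (C.isComponent k) hw' hw hx, hd⟩).2
  omega

/-! ### Distances between the runs of a chain. -/

section Metric

variable (hH : H.Connected) (hR : ∀ i j, i ≤ j → H.dist (R i) (R j) = j - i)
include hH hR

/-- A vertex of a component may be arbitrarily far from `R`, but once it is close to a vertex
outside the component it is close to an attachment. So two vertices at distance at most 3 would both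
be within 50 of `R`, at indices at least 200 apart, contradicting that `R` is geodesic. -/
theorem three_lt_dist {p q p' q' : ℕ} {u w : V} (hu : C.Located p q u) (hw : C.Located p' q' w)
    (h : q + 200 ≤ p') : 3 < H.dist u w := by
  by_contra hcon
  have hcomm := H.dist_comm (u := u) (v := w)
  have near : ∀ z z', z ≤ q → p' ≤ z' → H.dist u (R z) ≤ 50 → H.dist w (R z') ≤ 50 → False := by
    intro z z' hz hz' h1 h2
    have h3 := hR z z' (by omega)
    have h4 : H.dist (R z) (R z') ≤ H.dist (R z) u + H.dist u (R z') := hH.dist_triangle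
    have h5 : H.dist u (R z') ≤ H.dist u w + H.dist w (R z') := hH.dist_triangle
    rw [H.dist_comm (u := R z) (v := u)] at h4
    omega
  rcases hu with ⟨k, hk, hk', hu⟩ | ⟨z, hz, hz', hu⟩ <;>
    rcases hw with ⟨l, hl, hl', hw⟩ | ⟨y, hy, hy', hw⟩
  · have hb : C.b k < C.b l := by have := C.a_le_b l; omega
    obtain ⟨z, hz, hzd⟩ := (C.isComponent k).exists_attached hH hu
      (fun hwk => C.notMem_of_lt hb hwk hw)
    obtain ⟨y, hy, hyd⟩ := (C.isComponent l).exists_attached hH hw (C.notMem_of_lt hb hu)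
    have := C.le_of_attached k z hz
    have := C.le_of_attached l y hy
    exact near z y (by omega) (by omega) (by omega) (by omega)
  · obtain ⟨z, hz, hzd⟩ := (C.isComponent k).exists_attached hH hu (C.notMem_E k y)
    have := C.le_of_attached k z hz
    have h5 : H.dist u (R y) ≤ H.dist u w + H.dist w (R y) := hH.dist_triangle
    exact near z y (by omega) (by omega) (by omega) (by omega)
  · obtain ⟨y, hy, hyd⟩ := (C.isComponent l).exists_attached hH hw (C.notMem_E l z)
    have := C.le_of_attached l y hy
    have h5 : H.dist w (R z) ≤ H.dist w u + H.dist u (R z) := hH.dist_triangle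
    exact near z y (by omega) (by omega) (by omega) (by omega)
  · exact near z y (by omega) (by omega) (by omega) (by omega)

omit hH hR in
theorem located_of_mem {k : ℕ} {u : V} (hu : u ∈ C.E k) : C.Located (C.a k) (C.b k) u :=
  Or.inl ⟨k, le_rfl, le_rfl, hu⟩

omit hH hR in
theorem located_self (z : ℕ) : C.Located z z (R z) := Or.inr ⟨z, le_rfl, le_rfl, by simp⟩

omit hR in
theorem located_link_left {k : ℕ} {u : V} (hu : u ∈ C.link k) :
    C.Located (C.a k) (C.b k) u := by
  obtain ⟨x, hx, y, hy, hd⟩ := hu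
  have hb : C.b k < C.b (k + 1) := by have := C.b_succ k; omega
  obtain ⟨z, hz, hzd⟩ := (C.isComponent k).exists_attached hH hx
    (fun hyk => C.notMem_of_lt hb hyk hy)
  have h1 := C.le_of_attached k z hz
  have h2 := C.δ_le k
  have h3 : H.dist x y ≤ H.dist x u + H.dist u y := hH.dist_triangle
  have h4 : H.dist u (R z) ≤ H.dist u x + H.dist x (R z) := hH.dist_triangle
  rw [H.dist_comm (u := u) (v := x)] at h4
  -- At most 12 from `u` to `x` and 12 + 10 from `x` to the attachment: this is the 34 of `Located`.
  exact Or.inr ⟨z, h1.1, h1.2, by omega⟩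

omit hR in
theorem located_link_right {k : ℕ} {u : V} (hu : u ∈ C.link k) :
    C.Located (C.a (k + 1)) (C.b (k + 1)) u := by
  obtain ⟨x, hx, y, hy, hd⟩ := hu
  have hb : C.b k < C.b (k + 1) := by have := C.b_succ k; omega
  obtain ⟨z, hz, hzd⟩ := (C.isComponent (k + 1)).exists_attached hH hy
    (C.notMem_of_lt hb hx)
  have h1 := C.le_of_attached (k + 1) z hz
  have h2 := C.δ_le k
  have h3 : H.dist x y ≤ H.dist x u + H.dist u y := hH.dist_triangle
  have h4 : H.dist u (R z) ≤ H.dist u y + H.dist y (R z) := hH.dist_triangle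
  rw [H.dist_comm (u := x) (v := y)] at h3
  exact Or.inr ⟨z, h1.1, h1.2, by omega⟩

omit hH hR in
theorem located_conn {k z : ℕ} {u : V} (hu : u ∈ C.conn k z) : C.Located z z u := by
  obtain ⟨e, he, hd⟩ := hu
  rw [H.dist_comm] at hd
  exact Or.inr ⟨z, le_rfl, le_rfl, by omega⟩

-- Both ends of a link path are at distance at least 11 from `R`, and one of them is within 6 of
-- `u`.
omit hR in
theorem dist_link_R {k : ℕ} {u : V} (hu : u ∈ C.link k) (z : ℕ) : 3 < H.dist u (R z) := by
  obtain ⟨x, hx, y, hy, hd⟩ := hu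
  have h1 := C.far_of_mem hx z
  have h2 := C.far_of_mem hy z
  have h3 := C.δ_le k
  have h4 : H.dist x (R z) ≤ H.dist x u + H.dist u (R z) := hH.dist_triangle
  have h5 : H.dist y (R z) ≤ H.dist y u + H.dist u (R z) := hH.dist_triangle
  rw [H.dist_comm (u := y) (v := u)] at h5
  omega

omit hR in
/-- A component close to a path from `R z` to the `k`th component is close to the latter. -/
theorem exists_close_of_conn {k l z : ℕ} {u w : V} (hu : u ∈ C.conn k z) (hw : w ∈ C.E l)
    (h : H.dist u w ≤ 3) : ∃ e ∈ C.E k, H.dist e w ≤ 6 := by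
  obtain ⟨e, he, hd⟩ := hu
  have h1 := C.far_of_mem hw z
  have h2 : H.dist w (R z) ≤ H.dist w u + H.dist u (R z) := hH.dist_triangle
  have h3 : H.dist e w ≤ H.dist e u + H.dist u w := hH.dist_triangle
  rw [H.dist_comm (u := w) (v := u), H.dist_comm (u := u) (v := R z)] at h2
  rw [H.dist_comm (u := e) (v := u)] at h3
  -- Since `w` is at least 11 away from `R z`, `u` is at least 8 away. This leaves at most 3 for the
  -- rest of the path from `u` to `e`.
  exact ⟨e, he, by omega⟩

omit hR in
/-- If a short path between two components is close to a path from `R z` to a third one, then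
both components are close to the third one. -/
theorem exists_close_of_conn_link {k l z : ℕ} {u w : V} (hu : u ∈ C.conn k z)
    (hw : w ∈ C.link l) (hl : C.δ l ≤ 6) (h : H.dist u w ≤ 3) :
    (∃ e ∈ C.E k, ∃ x ∈ C.E l, H.dist e x ≤ 12) ∧
      ∃ e ∈ C.E k, ∃ y ∈ C.E (l + 1), H.dist e y ≤ 12 := by
  obtain ⟨e, he, hd⟩ := hu
  obtain ⟨x, hx, y, hy, hxy⟩ := hw
  have h1 := C.far_of_mem hx z
  have h2 := C.far_of_mem hy z
  have h3 : H.dist x (R z) ≤ H.dist x w + H.dist w (R z) := hH.dist_triangle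
  have h4 : H.dist y (R z) ≤ H.dist y w + H.dist w (R z) := hH.dist_triangle
  have h5 : H.dist w (R z) ≤ H.dist w u + H.dist u (R z) := hH.dist_triangle
  have h6 : H.dist e x ≤ H.dist e u + H.dist u x := hH.dist_triangle
  have h7 : H.dist e y ≤ H.dist e u + H.dist u y := hH.dist_triangle
  have h8 : H.dist u x ≤ H.dist u w + H.dist w x := hH.dist_triangle
  have h9 : H.dist u y ≤ H.dist u w + H.dist w y := hH.dist_triangle
  rw [H.dist_comm (u := y) (v := w)] at h4
  rw [H.dist_comm (u := w) (v := u), H.dist_comm (u := u) (v := R z)] at h5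
  rw [H.dist_comm (u := e) (v := u)] at h6 h7
  rw [H.dist_comm (u := w) (v := x)] at h8
  -- Let `s`, `t` be the distances from `w` to `x` and `y`, so `s + t ≤ 6`. Then `w` is at least `11
  -- - min s t` from `R z`, so `u` is within `3 + min s t` of `e`, and `e` is within `6 + min s t +
  -- max s t ≤ 12` of both `x` and `y`.
  exact ⟨⟨e, he, x, hx, by omega⟩, ⟨e, he, y, hy, by omega⟩⟩

/-- Runs on the two sides of a break are far apart. -/
theorem three_lt_dist_run {f g f' g' : ℕ} (hg : C.IsBreak g) (hfg : f ≤ g) (hfg' : f' ≤ g')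
    (hgf : f' = g + 1 ∨ g + 3 ≤ f') {u w : V} (hu : u ∈ C.run f g) (hw : w ∈ C.run f' g') :
    3 < H.dist u w := by
  have hlt : g + 1 ≤ f' := by omega
  have hcomm := H.dist_comm (u := u) (v := w)
  have sep := fun {p q p' q'} => C.three_lt_dist hH hR (p := p) (q := q) (p' := p') (q' := q')
    (u := u) (w := w)
  -- In most cases the locations along `R` are 200 apart. The exceptions involve components that are
  -- neighbours across the break, handled by `hg`, or two apart, handled by `sep_two`.
  rcases hu with ⟨k, hk, hkg, hu⟩ | ⟨k, hk, hkg, hu⟩ | hu | hu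
  · have lu := C.located_of_mem hu
    rcases hw with ⟨l, hl, hlg, hw⟩ | ⟨l, hl, hlg, hw⟩ | hw | hw
    · have lw := C.located_of_mem hw
      by_cases hkl : k + 3 ≤ l
      · exact sep lu lw (C.b_lt_a hkl)
      obtain ⟨rfl, rfl⟩ | rfl : (k = g ∧ l = g + 1) ∨ l = k + 2 := by omega
      · have := hg.1 u hu w hw; omega
      · rcases C.sep_two k with h | h
        · exact sep lu lw h
        · have := h.1 u hu w hw; omega
    · by_cases hkl : k + 3 ≤ l + 1
      · exact sep lu (C.located_link_right hH hw) (C.b_lt_a hkl)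
      obtain ⟨rfl, rfl⟩ : k = g ∧ l = g + 1 := by omega
      rcases C.sep_two k with h | ⟨h, h1, h2⟩
      · exact sep lu (C.located_link_right hH hw) h
      · obtain ⟨x, hx, y, hy, hxy⟩ := hw
        have h3 := h u hu y hy
        have h4 : H.dist u y ≤ H.dist u w + H.dist w y := hH.dist_triangle
        omega
    · by_cases hkl : k + 3 ≤ f'
      · exact sep lu (C.located_conn hw) (C.b_lt_a hkl)
      by_contra hcon
      obtain ⟨e, he, hd⟩ := C.exists_close_of_conn hH hw hu (by omega)
      rw [dist_comm] at hd
      obtain ⟨rfl, rfl⟩ | rfl : (k = g ∧ f' = g + 1) ∨ f' = k + 2 := by omega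
      · have := hg.1 u hu e he; omega
      · rcases C.sep_two k with h | h
        · exact hcon (sep lu (C.located_conn hw) h)
        · have := h.1 u hu e he; omega
    · exact sep lu (C.located_conn hw) (C.b_lt (by omega))
  · have lu := C.located_link_left hH hu
    rcases hw with ⟨l, hl, hlg, hw⟩ | ⟨l, hl, hlg, hw⟩ | hw | hw
    · have lw := C.located_of_mem hw
      by_cases hkl : k + 3 ≤ l
      · exact sep lu lw (C.b_lt_a hkl)
      obtain rfl : l = k + 2 := by omega
      rcases C.sep_two k with h | ⟨h, h1, h2⟩
      · exact sep lu lw h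
      · obtain ⟨x, hx, y, hy, hxy⟩ := hu
        have h3 := h x hx w hw
        have h4 : H.dist x w ≤ H.dist x u + H.dist u w := hH.dist_triangle
        omega
    · exact sep lu (C.located_link_right hH hw) (C.b_lt_a (by omega))
    · by_cases hkl : k + 3 ≤ f'
      · exact sep lu (C.located_conn hw) (C.b_lt_a hkl)
      obtain rfl : f' = k + 2 := by omega
      rcases C.sep_two k with h | ⟨h, h1, h2⟩
      · exact sep lu (C.located_conn hw) h
      · by_contra hcon
        obtain ⟨⟨e, he, x, hx, hd⟩, -⟩ := C.exists_close_of_conn_link hH hw hu h1 (by omega)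
        have := h x hx e he
        rw [dist_comm] at this
        omega
    · exact sep lu (C.located_conn hw) (C.b_lt (by omega))
  · have lu := C.located_conn hu
    rcases hw with ⟨l, hl, hlg, hw⟩ | ⟨l, hl, hlg, hw⟩ | hw | hw
    · exact sep lu (C.located_of_mem hw) (C.a_lt (by omega))
    · exact sep lu (C.located_link_left hH hw) (C.a_lt (by omega))
    · exact sep lu (C.located_conn hw) (C.a_lt (by omega))
    · exact sep lu (C.located_conn hw)
        ((C.a_lt (j := g') (by omega)).trans (C.a_le_b g'))
  · have lu := C.located_conn hu
    rcases hw with ⟨l, hl, hlg, hw⟩ | ⟨l, hl, hlg, hw⟩ | hw | hw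
    · have lw := C.located_of_mem hw
      by_cases hkl : g + 3 ≤ l
      · exact sep lu lw (C.b_lt_a hkl)
      by_contra hcon
      obtain ⟨e, he, hd⟩ := C.exists_close_of_conn hH hu hw (by omega)
      obtain rfl | rfl : l = g + 1 ∨ l = g + 2 := by omega
      · have := hg.1 e he w hw; omega
      · rcases C.sep_two g with h | h
        · exact hcon (sep lu lw h)
        · have := h.1 e he w hw; omega
    · by_cases hkl : g + 3 ≤ l + 1
      · exact sep lu (C.located_link_right hH hw) (C.b_lt_a hkl)
      obtain rfl : l = g + 1 := by omega
      rcases C.sep_two g with h | ⟨h, h1, h2⟩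
      · exact sep lu (C.located_link_right hH hw) h
      · by_contra hcon
        obtain ⟨-, e, he, y, hy, hd⟩ := C.exists_close_of_conn_link hH hu hw h2 (by omega)
        have := h e he y hy
        omega
    -- Both vertices are near `R`, at `b g` and `a f'`. For `f' = g + 1` the break puts `a f'` well
    -- before `b g`; for `g + 3 ≤ f'` it comes well after. For `f' = g + 2` the order is not
    -- determined, which is why that case is excluded.
    · rcases hgf with rfl | hgf
      · have := C.three_lt_dist hH hR (C.located_conn hw) lu hg.2
        omega
      · exact sep lu (C.located_conn hw) (C.b_lt_a hgf)
    · exact sep lu (C.located_conn hw) (C.b_lt (by omega))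

/-- A run is far from the vertices of `R` away from its two ends. -/
theorem three_lt_dist_R {f g z : ℕ} (ha : z + 200 ≤ C.a f ∨ C.a f + 200 ≤ z)
    (hb : z + 200 ≤ C.b g ∨ C.b g + 200 ≤ z) {u : V} (hu : u ∈ C.run f g) :
    3 < H.dist u (R z) := by
  have hcomm := H.dist_comm (u := u) (v := R z)
  have lz := C.located_self z
  rcases hu with ⟨k, hk, hkg, hu⟩ | ⟨k, hk, hkg, hu⟩ | hu | hu
  · have := C.far_of_mem hu z; omega
  · exact C.dist_link_R hH hu z
  · rcases ha with ha | ha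
    · rw [hcomm]; exact C.three_lt_dist hH hR lz (C.located_conn hu) ha
    · exact C.three_lt_dist hH hR (C.located_conn hu) lz ha
  · rcases hb with hb | hb
    · rw [hcomm]; exact C.three_lt_dist hH hR lz (C.located_conn hu) hb
    · exact C.three_lt_dist hH hR (C.located_conn hu) lz hb

end Metric

/-! ### Connectedness of runs. -/

section Connected

variable (hH : H.Connected)
include hH

theorem link_reachable {k : ℕ} {u : V} (hu : u ∈ C.link k) :
    ∃ x ∈ C.E k, ∃ y ∈ C.E (k + 1), H.ReachableIn (C.link k) x u ∧
      H.ReachableIn (C.link k) u y := by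
  obtain ⟨x, hx, y, hy, hd⟩ := hu
  refine ⟨x, hx, y, hy, .of_dist hH fun v hv => ⟨x, hx, y, hy, ?_⟩,
    .of_dist hH fun v hv => ⟨x, hx, y, hy, ?_⟩⟩
  · have h1 : H.dist v y ≤ H.dist v u + H.dist u y := hH.dist_triangle
    omega
  · have h1 : H.dist x v ≤ H.dist x u + H.dist u v := hH.dist_triangle
    omega

theorem conn_reachable {k z : ℕ} {u : V} (hu : u ∈ C.conn k z) :
    ∃ e ∈ C.E k, H.ReachableIn (C.conn k z) e u := by
  obtain ⟨e, he, hd⟩ := hu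
  refine ⟨e, he, .of_dist hH fun v hv => ⟨e, he, ?_⟩⟩
  have h1 : H.dist (R z) v ≤ H.dist (R z) u + H.dist u v := hH.dist_triangle
  rw [H.dist_comm (u := e) (v := v), H.dist_comm (u := v) (v := u),
    H.dist_comm (u := e) (v := u)] at hv
  omega

omit hH in
theorem R_mem_conn {k z : ℕ} (h : H.Attached R (C.E k) z) : R z ∈ C.conn k z := by
  obtain ⟨e, he, hd⟩ := h
  rw [dist_comm] at hd
  exact ⟨e, he, by simpa using hd⟩

theorem reachable_of_links {W : Set V} {f g : ℕ} (hE : ∀ k, f ≤ k → k ≤ g → C.E k ⊆ W)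
    (hL : ∀ k, f ≤ k → k < g → C.link k ⊆ W) (hlink : ∀ k, f ≤ k → k < g → ¬ C.IsBreak k)
    (hfg : f ≤ g) {e u : V} (he : e ∈ C.E f) (hu : u ∈ C.E g) : H.ReachableIn W e u := by
  induction g, hfg using Nat.le_induction generalizing u with
  | base => exact ((C.isComponent f).connectedOn e he u hu).mono (hE f le_rfl le_rfl)
  | succ g hfg ih =>
    obtain ⟨x, hx, y, hy, hd⟩ := (C.break_or_link g).resolve_left (hlink g hfg (by omega))
    have hxL : x ∈ C.link g := ⟨x, hx, y, hy, by simpa using hd⟩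
    obtain ⟨x', hx', y', hy', h1, h2⟩ := C.link_reachable hH hxL
    exact ((ih (fun k h1 h2 => hE k h1 (by omega)) (fun k h1 h2 => hL k h1 (by omega))
      (fun k h1 h2 => hlink k h1 (by omega)) hx).trans
        (h2.mono (hL g hfg (by omega)))).trans
      (((C.isComponent (g + 1)).connectedOn y' hy' u hu).mono (hE (g + 1) (by omega) le_rfl))

theorem connectedOn_run {f g : ℕ} (hfg : f ≤ g) (hlink : ∀ k, f ≤ k → k < g → ¬ C.IsBreak k) :
    H.ConnectedOn (C.run f g) := by
  obtain ⟨e, he, -⟩ := C.attached_a f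
  have hE : ∀ k, f ≤ k → k ≤ g → C.E k ⊆ C.run f g := fun k h1 h2 u hu => Or.inl ⟨k, h1, h2, hu⟩
  have hL : ∀ k, f ≤ k → k < g → C.link k ⊆ C.run f g :=
    fun k h1 h2 u hu => Or.inr (Or.inl ⟨k, h1, h2, hu⟩)
  have hA : C.conn f (C.a f) ⊆ C.run f g := fun u hu => Or.inr (Or.inr (Or.inl hu))
  have hB : C.conn g (C.b g) ⊆ C.run f g := fun u hu => Or.inr (Or.inr (Or.inr hu))
  have key : ∀ k, f ≤ k → k ≤ g → ∀ u ∈ C.E k, H.ReachableIn (C.run f g) e u :=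
    fun k h1 h2 u hu => C.reachable_of_links hH (fun j h3 h4 => hE j h3 (by omega))
      (fun j h3 h4 => hL j h3 (by omega)) (fun j h3 h4 => hlink j h3 (by omega)) h1 he hu
  have all : ∀ u ∈ C.run f g, H.ReachableIn (C.run f g) e u := by
    rintro u (⟨k, h1, h2, hu⟩ | ⟨k, h1, h2, hu⟩ | hu | hu)
    · exact key k h1 h2 u hu
    · obtain ⟨x, hx, -, -, h3, -⟩ := C.link_reachable hH hu
      exact (key k h1 h2.le x hx).trans (h3.mono (hL k h1 h2))
    · obtain ⟨x, hx, h3⟩ := C.conn_reachable hH hu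
      exact (key f le_rfl hfg x hx).trans (h3.mono hA)
    · obtain ⟨x, hx, h3⟩ := C.conn_reachable hH hu
      exact (key g hfg le_rfl x hx).trans (h3.mono hB)
  exact fun x hx y hy => (all x hx).symm.trans (all y hy)

/-- If there is no break from some index on, the components from there on are connected to each
other far from `R`. -/
theorem exists_unbounded_of_no_break {f : ℕ} (hf : ∀ k, f ≤ k → ¬ C.IsBreak k) :
    ∃ S ⊆ H.farSet R 3, H.ConnectedOn S ∧ ∀ n, ∃ z, n ≤ z ∧ H.Attached R S z := by
  obtain ⟨e, he, -⟩ := C.attached_a f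
  let S : Set V := {u | ∃ k, f ≤ k ∧ (u ∈ C.E k ∨ u ∈ C.link k)}
  have key : ∀ k, f ≤ k → ∀ u ∈ C.E k, H.ReachableIn S e u :=
    fun k h1 u hu => C.reachable_of_links (W := S) hH (fun j h3 _ v hv => ⟨j, h3, Or.inl hv⟩)
      (fun j h3 _ v hv => ⟨j, h3, Or.inr hv⟩) (fun j h3 _ => hf j h3) h1 he hu
  have all : ∀ u ∈ S, H.ReachableIn S e u := by
    rintro u ⟨k, h1, hu | hu⟩
    · exact key k h1 u hu
    · obtain ⟨x, hx, -, -, h3, -⟩ := C.link_reachable hH hu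
      exact (key k h1 x hx).trans (h3.mono fun v hv => ⟨k, h1, Or.inr hv⟩)
  refine ⟨S, ?_, fun x hx y hy => (all x hx).symm.trans (all y hy), fun n => ?_⟩
  · rintro u ⟨k, -, hu | hu⟩ z
    · have := C.far_of_mem hu z; omega
    · exact C.dist_link_R hH hu z
  · have hb : ∀ k, k ≤ C.b k := by
      intro k
      induction k with
      | zero => omega
      | succ k ih => have := C.b_succ k; omega
    obtain ⟨x, hx, hd⟩ := C.attached_b (max f n)
    exact ⟨_, (le_max_right f n).trans (hb _), x, ⟨_, le_max_left f n, Or.inl hx⟩, hd⟩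

end Connected

end JumpChain

end SimpleGraph

/-! ### The two alternating routes of a chain with infinitely many breaks. -/

namespace SimpleGraph

universe u

variable {V : Type u}

namespace JumpChain

variable {H : SimpleGraph V} {R : ℕ → V} (C : JumpChain H R)

/-- The vertices of `R` with index between `i` and `j`. -/
def segment (R : ℕ → V) (i j : ℕ) : Set V := {v | ∃ z, min i j ≤ z ∧ z ≤ max i j ∧ v = R z}

theorem connectedOn_segment (hadj : ∀ n, H.Adj (R n) (R (n + 1))) (i j : ℕ) :
    H.ConnectedOn (segment R i j) := by
  have key : ∀ a b, min i j ≤ a → a ≤ b → b ≤ max i j →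
      H.ReachableIn (segment R i j) (R a) (R b) := fun a b ha hab hb =>
    .of_seq hab (fun n _ _ => hadj n) fun n h1 h2 => ⟨n, by omega, by omega, rfl⟩
  rintro _ ⟨a, ha, ha', rfl⟩ _ ⟨b, hb, hb', rfl⟩
  rcases le_total a b with h | h
  · exact key a b ha h hb'
  · exact (key b a hb h ha').symm

/-- A chain with infinitely many breaks can be split into two connected sets far apart from each
other that both follow `R`. -/
theorem exists_routes (hH : H.Connected) (hadj : ∀ n, H.Adj (R n) (R (n + 1)))
    (hR : ∀ i j, i ≤ j → H.dist (R i) (R j) = j - i) (hbreak : {k | C.IsBreak k}.Infinite) :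
    ∃ A B : Set V, H.ConnectedOn A ∧ H.ConnectedOn B ∧ (∀ u ∈ A, ∀ w ∈ B, 3 < H.dist u w) ∧
      (∀ n, ∃ z, n ≤ z ∧ R z ∈ A) ∧ ∀ n, ∃ z, n ≤ z ∧ R z ∈ B := by
  -- Run `i` begins just after one break and ends at the next, so there is no break inside it.
  let g : ℕ → ℕ := fun i => Nat.nth C.IsBreak (i + 1)
  let f : ℕ → ℕ := fun i => Nat.nth C.IsBreak i + 1
  have hmono := Nat.nth_strictMono hbreak
  have hg : ∀ i, C.IsBreak (g i) := fun i => Nat.nth_mem_of_infinite hbreak _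
  have hf_succ : ∀ i, f (i + 1) = g i + 1 := fun i => rfl
  have hfg : ∀ i, f i ≤ g i := fun i => hmono (Nat.lt_succ_self i)
  have hlink : ∀ i k, f i ≤ k → k < g i → ¬ C.IsBreak k := by
    intro i k h1 h2 h3
    have := Nat.le_nth_of_lt_nth_succ h2 h3
    have : Nat.nth C.IsBreak i + 1 ≤ k := h1
    omega
  have hgf : ∀ i j, i + 1 < j → g i + 2 ≤ f j := by
    intro i j hij
    have h1 := hfg (i + 1)
    have h2 := hf_succ i
    have h3 : g (i + 1) ≤ Nat.nth C.IsBreak j := hmono.monotone (by omega)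
    have h4 : f j = Nat.nth C.IsBreak j + 1 := rfl
    omega
  have hgf3 : ∀ i j, i + 2 < j → g i + 3 ≤ f j := by
    intro i j hij
    have h1 := hfg (i + 2)
    have h2 := hgf i (i + 2) (by omega)
    have h3 : g (i + 2) ≤ Nat.nth C.IsBreak j := hmono.monotone (by omega)
    have h4 : f j = Nat.nth C.IsBreak j + 1 := rfl
    omega
  have fmono : StrictMono f := fun i j h => Nat.succ_lt_succ (hmono h)
  have gmono : StrictMono g := fun i j h => hmono (Nat.succ_lt_succ h)
  let α : ℕ → ℕ := fun i => C.a (f i)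
  let β : ℕ → ℕ := fun i => C.b (g i)
  have hα : ∀ i j, i < j → α i + 200 ≤ α j := fun i j h => C.a_lt (fmono h)
  have hβ : ∀ i j, i < j → β i + 200 ≤ β j := fun i j h => C.b_lt (gmono h)
  have hα' : ∀ i j, i ≤ j → α i ≤ α j := fun i j h => C.a_mono (fmono.monotone h)
  have hβ' : ∀ i j, i ≤ j → β i ≤ β j := fun i j h => C.b_mono (gmono.monotone h)
  have hαβ : ∀ i, α (i + 1) + 200 ≤ β i := fun i => (hg i).2
  have hβα : ∀ i j, i + 2 < j → β i + 200 ≤ α j := fun i j h => C.b_lt_a (hgf3 i j h)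
  let S : ℕ → Set V := fun i => C.run (f i) (g i)
  -- `Q i` leads from the end of run `i` to the start of run `i + 2`, in either direction along `R`.
  -- Its indices are at least 200 after `α (i + 1)` and at least 200 before `β (i + 1)` and `α (i +
  -- 3)`, so it keeps away from the ends of all runs of the other parity.
  let Q : ℕ → Set V := fun i => segment R (β i) (α (i + 2))
  have hSS' : ∀ i j, i < j → i + 2 ≠ j → ∀ u ∈ S i, ∀ w ∈ S j, 3 < H.dist u w := by
    intro i j hij hne u hu w hw
    refine C.three_lt_dist_run hH hR (hg i) (hfg i) (hfg j) ?_ hu hw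
    rcases Nat.lt_or_ge (i + 1) j with h | h
    · exact Or.inr (hgf3 i j (by omega))
    · obtain rfl : j = i + 1 := by omega
      exact Or.inl (hf_succ i)
  have hSS : ∀ i j, (i + j) % 2 = 1 → ∀ u ∈ S i, ∀ w ∈ S j, 3 < H.dist u w := by
    intro i j hij u hu w hw
    rcases lt_trichotomy i j with h | h | h
    · exact hSS' i j h (by omega) u hu w hw
    · omega
    · rw [dist_comm]; exact hSS' j i h (by omega) w hw u hu
  have hSQ : ∀ i j, (i + j) % 2 = 1 → ∀ u ∈ S i, ∀ w ∈ Q j, 3 < H.dist u w := by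
    rintro i j hij u hu _ ⟨z, hz, hz', rfl⟩
    have h1 := hαβ j
    have h2 := hα (j + 1) (j + 2) (by omega)
    have h3 : α (j + 2) + 200 ≤ β (j + 1) := hαβ (j + 1)
    have h4 := hβ j (j + 1) (by omega)
    refine C.three_lt_dist_R hH hR ?_ ?_ hu
    · rcases Nat.lt_or_ge (j + 1) i with h | h
      · left
        have h5 := hα (j + 2) i (by omega)
        have h6 := hβα j i (by omega)
        change z + 200 ≤ α i
        omega
      · right
        have h5 := hα' i (j + 1) h
        change α i + 200 ≤ z
        omega
    · rcases Nat.lt_or_ge j i with h | h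
      · left
        have h5 := hβ' (j + 1) i h
        change z + 200 ≤ β i
        omega
      · right
        have h5 := hβ i j (by omega)
        have h6 := hβα i (j + 2) (by omega)
        change β i + 200 ≤ z
        omega
  have hQQ' : ∀ i j, i < j → ∀ u ∈ Q i, ∀ w ∈ Q j, 3 < H.dist u w := by
    rintro i j hij _ ⟨z, hz, hz', rfl⟩ _ ⟨y, hy, hy', rfl⟩
    have h1 := hβ i j hij
    have h2 := hβα i (j + 2) (by omega)
    have h3 : α (i + 2) + 200 ≤ β (i + 1) := hαβ (i + 1)
    have h4 := hβ' (i + 1) j hij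
    have h5 := hα (i + 2) (j + 2) (by omega)
    rw [hR z y (by omega)]
    omega
  have hQQ : ∀ i j, (i + j) % 2 = 1 → ∀ u ∈ Q i, ∀ w ∈ Q j, 3 < H.dist u w := by
    intro i j hij u hu w hw
    rcases lt_trichotomy i j with h | h | h
    · exact hQQ' i j h u hu w hw
    · omega
    · rw [dist_comm]; exact hQQ' j i h w hw u hu
  have hαS : ∀ i, R (α i) ∈ S i := fun i =>
    Or.inr (Or.inr (Or.inl (C.R_mem_conn (C.attached_a _))))
  have hβS : ∀ i, R (β i) ∈ S i := fun i =>
    Or.inr (Or.inr (Or.inr (C.R_mem_conn (C.attached_b _))))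
  have hβQ : ∀ i, R (β i) ∈ Q i := fun i => ⟨β i, min_le_left _ _, le_max_left _ _, rfl⟩
  have hαQ : ∀ i, R (α (i + 2)) ∈ Q i := fun i => ⟨_, min_le_right _ _, le_max_right _ _, rfl⟩
  have hconn : ∀ i, H.ConnectedOn (S i ∪ Q i) := fun i =>
    (C.connectedOn_run hH (hfg i) (hlink i)).union (connectedOn_segment hadj _ _) (hβS i) (hβQ i)
  have hle : ∀ i, i ≤ α i := by
    intro i
    induction i with
    | zero => omega
    | succ i ih => have := hα i (i + 1) (by omega); omega
  refine ⟨⋃ n, S (2 * n) ∪ Q (2 * n), ⋃ n, S (2 * n + 1) ∪ Q (2 * n + 1),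
    ConnectedOn.iUnion_seq (fun n => hconn _) fun n => ⟨_, Or.inr (hαQ _), Or.inl (hαS _)⟩,
    ConnectedOn.iUnion_seq (fun n => hconn _) fun n => ⟨_, Or.inr (hαQ _), Or.inl (hαS _)⟩,
    fun u hu w hw => ?_, fun n => ⟨α (2 * n), ?_, ?_⟩, fun n => ⟨α (2 * n + 1), ?_, ?_⟩⟩
  · obtain ⟨i, hu⟩ := Set.mem_iUnion.1 hu
    obtain ⟨j, hw⟩ := Set.mem_iUnion.1 hw
    rcases hu with hu | hu <;> rcases hw with hw | hw
    · exact hSS _ _ (by omega) u hu w hw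
    · exact hSQ _ _ (by omega) u hu w hw
    · rw [dist_comm]; exact hSQ _ _ (by omega) w hw u hu
    · exact hQQ _ _ (by omega) u hu w hw
  · have := hle (2 * n); omega
  · exact Set.mem_iUnion.2 ⟨n, Or.inl (hαS _)⟩
  · have := hle (2 * n + 1); omega
  · exact Set.mem_iUnion.2 ⟨n, Or.inl (hαS _)⟩

end JumpChain

end SimpleGraph

/-! ### From balls that do not separate to chains of jumps. -/

namespace SimpleGraph

universe u

variable {V : Type u} {H : SimpleGraph V} {R : ℕ → V}

theorem isComponentOf_setOf_reachableIn (U : Set V) (x : V) :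
    H.IsComponentOf U {y | H.ReachableIn U x y} where
  subset _ hy := hy.mem_right
  connectedOn := by
    have key : ∀ y, H.ReachableIn U x y → H.ReachableIn {y | H.ReachableIn U x y} x y := by
      rintro y hxy
      exact (hxy.induct (P := fun v => H.ReachableIn U x v ∧
          H.ReachableIn {y | H.ReachableIn U x y} x v)
        (fun u v hu hv h ⟨h1, h2⟩ => by
          have h3 := h1.trans (.of_adj h hu hv)
          exact ⟨h3, h2.trans (.of_adj h h1 h3)⟩)
        ⟨.refl hxy.mem_left, .refl (.refl hxy.mem_left)⟩).2
    exact fun y hy z hz => (key y hy).symm.trans (key z hz)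
  closed _ hx _ hy h := hx.trans (.of_adj h hx.mem_right hy)

/-- If the ball of radius `1010` around `R i` does not separate `R 0` from the vertices of `R`
beyond it, then some component of the vertices far from `R` jumps over `i`. -/
theorem exists_jump (hH : H.Connected) (hR : ∀ i j, i ≤ j → H.dist (R i) (R j) = j - i) {i l : ℕ}
    (hil : i < l) (h : H.ReachableIn {v | 1010 < H.dist (R i) v} (R 0) (R l)) :
    ∃ E, H.IsComponentOf (H.farSet R 10) E ∧ ∃ z z', H.Attached R E z ∧ H.Attached R E z' ∧
      z + 1000 ≤ i ∧ i + 1000 ≤ z' := by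
  by_contra! hcon
  set S : Set V := {v | 1010 < H.dist (R i) v} with hS
  set U := H.farSet R 10 with hU
  have hgap : ∀ v ∈ S, ∀ z, H.dist v (R z) ≤ 10 → z + 1000 ≤ i ∨ i + 1000 ≤ z := by
    intro v hv z hz
    have h1 : 1010 < H.dist (R i) v := hv
    have h2 : H.dist (R i) v ≤ H.dist (R i) (R z) + H.dist (R z) v := hH.dist_triangle
    rw [H.dist_comm (u := R z) (v := v)] at h2
    rcases le_total i z with h | h
    · rw [hR i z h] at h2; omega
    · rw [H.dist_comm (u := R i) (v := R z), hR z i h] at h2; omega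
  -- Invariant along the walk: the current vertex is near `R` at an index up to `i`, or lies in a
  -- component attached well before `i`. Without a jump over `i` the walk cannot get near `R` beyond
  -- `i`, since avoiding the ball keeps it away from indices within 1000 of `i`; but `R l` violates
  -- the invariant.
  have key := h.induct (P := fun v => (∃ z, z ≤ i ∧ H.dist v (R z) ≤ 10) ∨
      (v ∈ U ∧ ∃ z, z + 1000 ≤ i ∧ H.Attached R {y | H.ReachableIn U v y} z)) ?_
    (Or.inl ⟨0, by omega, by simp⟩)
  · rcases key with ⟨z, hz, hd⟩ | ⟨hlU, -⟩
    · have h1 : 1010 < H.dist (R i) (R l) := h.mem_right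
      rw [hR i l hil.le] at h1
      rw [dist_comm, hR z l (by omega)] at hd
      omega
    · have := hlU l
      simp at this
  intro u v hu hv huv hPu
  have huv1 := dist_eq_one_iff_adj.2 huv
  have tri : ∀ z, H.dist v (R z) ≤ 1 + H.dist u (R z) := fun z => by
    have h1 : H.dist v (R z) ≤ H.dist v u + H.dist u (R z) := hH.dist_triangle
    rwa [H.dist_comm (u := v) (v := u), huv1] at h1
  have tri' : ∀ z, H.dist u (R z) ≤ 1 + H.dist v (R z) := fun z => by
    have h1 : H.dist u (R z) ≤ H.dist u v + H.dist v (R z) := hH.dist_triangle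
    rwa [huv1] at h1
  by_cases hvU : v ∈ U
  · refine Or.inr ⟨hvU, ?_⟩
    rcases hPu with ⟨z, hz, hd⟩ | ⟨huU, z, hz, x, hx, hd⟩
    · have h1 := hgap u hu z hd
      have h2 := tri z
      exact ⟨z, by omega, v, .refl hvU, by omega⟩
    · exact ⟨z, hz, x, ReachableIn.trans (.of_adj huv.symm hvU huU) hx, hd⟩
  · obtain ⟨z, hz⟩ : ∃ z, H.dist v (R z) ≤ 10 := by simpa [hU, farSet] using hvU
    by_cases hzi : z ≤ i
    · exact Or.inl ⟨z, hzi, hz⟩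
    exfalso
    have h1 := hgap v hv z hz
    have h2 := tri' z
    rcases hPu with ⟨y, hy, hd⟩ | ⟨huU, y, hy, hyE⟩
    · have h3 := hgap u hu y hd
      have h4 : H.dist (R y) (R z) ≤ H.dist (R y) u + H.dist u (R z) := hH.dist_triangle
      rw [H.dist_comm (u := R y) (v := u), hR y z (by omega)] at h4
      omega
    · have := hcon _ (isComponentOf_setOf_reachableIn U u) y z hyE ⟨u, .refl huU, by omega⟩ hy
      omega

/-- Among the components attached before `p` there is one that reaches furthest. -/
theorem exists_furthest (hH : H.Connected) (hfin : ∀ v, (H.neighborSet v).Finite)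
    (hR : ∀ i j, i ≤ j → H.dist (R i) (R j) = j - i)
    (hbdd : ∀ S ⊆ H.farSet R 3, H.ConnectedOn S → ∃ n, ∀ z, H.Attached R S z → z ≤ n) {p : ℕ}
    (hp : ∃ E, H.IsComponentOf (H.farSet R 10) E ∧ ∃ z z', H.Attached R E z ∧ H.Attached R E z' ∧
      z ≤ p ∧ p + 2000 ≤ z') :
    ∃ (E : Set V) (a b : ℕ), H.IsComponentOf (H.farSet R 10) E ∧ H.Attached R E a ∧
      H.Attached R E b ∧ (∀ z, H.Attached R E z → a ≤ z ∧ z ≤ b) ∧ a ≤ p ∧ p + 2000 ≤ b ∧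
      ∀ E', H.IsComponentOf (H.farSet R 10) E' → ∀ z z', H.Attached R E' z → z ≤ p →
        H.Attached R E' z' → z' ≤ b := by
  classical
  set U := H.farSet R 10 with hU
  have hU3 : U ⊆ H.farSet R 3 := fun v hv z => by have := hv z; omega
  let Z : Set ℕ := {z' | ∃ E, H.IsComponentOf U E ∧ ∃ z, z ≤ p ∧ H.Attached R E z ∧
    H.Attached R E z'}
  have hcomp := fun x => isComponentOf_setOf_reachableIn (H := H) U x
  choose n hn using fun x => hbdd _ ((hcomp x).subset.trans hU3) (hcomp x).connectedOn
  have hF := finite_dist_le hH hfin (R 0) (p + 11)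
  -- A component attached at or before `p` has a vertex within `p + 11` of `R 0`. There are finitely
  -- many such vertices, hence finitely many such components, each with bounded attachments.
  have hZ : BddAbove Z := by
    refine ⟨hF.toFinset.sup n, ?_⟩
    rintro z' ⟨E, hE, z, hz, ⟨x, hx, hd⟩, ⟨y, hy, hd'⟩⟩
    have hxF : x ∈ hF.toFinset := by
      have h1 : H.dist (R 0) x ≤ H.dist (R 0) (R z) + H.dist (R z) x := hH.dist_triangle
      rw [hR 0 z (by omega), H.dist_comm (u := R z)] at h1
      simp only [Set.Finite.mem_toFinset, Set.mem_ofPred_eq]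
      omega
    exact (hn x z' ⟨y, (hE.connectedOn x hx y hy).mono hE.subset, hd'⟩).trans
      (Finset.le_sup (f := n) hxF)
  obtain ⟨E₀, hE₀, z₀, z₀', h1, h2, h3, h4⟩ := hp
  have hz₀ : z₀' ∈ Z := ⟨E₀, hE₀, z₀, h3, h1, h2⟩
  obtain ⟨E, hE, z, hz, hEz, hEb⟩ := Nat.sSup_mem ⟨_, hz₀⟩ hZ
  have hex : ∃ a, H.Attached R E a := ⟨z, hEz⟩
  refine ⟨E, Nat.find hex, sSup Z, hE, Nat.find_spec hex, hEb,
    fun y hy => ⟨Nat.find_min' hex hy, le_csSup hZ ⟨E, hE, z, hz, hEz, hy⟩⟩,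
    (Nat.find_min' hex hEz).trans hz, h4.trans (le_csSup hZ hz₀),
    fun E' hE' y y' hy hyp hy' => le_csSup hZ ⟨E', hE', y, hyp, hy, hy'⟩⟩

/-- If all large indices are jumped over, there is a sequence of overlapping jumps. -/
theorem exists_overlapping (hH : H.Connected) (hfin : ∀ v, (H.neighborSet v).Finite)
    (hR : ∀ i j, i ≤ j → H.dist (R i) (R j) = j - i)
    (hbdd : ∀ S ⊆ H.farSet R 3, H.ConnectedOn S → ∃ n, ∀ z, H.Attached R S z → z ≤ n) {i₀ : ℕ}
    (hjump : ∀ i, i₀ ≤ i → ∃ E, H.IsComponentOf (H.farSet R 10) E ∧ ∃ z z', H.Attached R E z ∧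
      H.Attached R E z' ∧ z + 1000 ≤ i ∧ i + 1000 ≤ z') :
    ∃ (E : ℕ → Set V) (a b : ℕ → ℕ), (∀ k, H.IsComponentOf (H.farSet R 10) (E k)) ∧
      (∀ k, H.Attached R (E k) (a k)) ∧ (∀ k, H.Attached R (E k) (b k)) ∧
      (∀ k z, H.Attached R (E k) z → a k ≤ z ∧ z ≤ b k) ∧ (∀ k, a (k + 1) + 200 ≤ b k) ∧
      (∀ k, a k + 200 ≤ a (k + 1)) ∧ (∀ k, b k + 200 ≤ b (k + 1)) ∧
      ∀ k, b k + 200 ≤ a (k + 3) := by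
  classical
  have hstep : ∀ p, i₀ ≤ p → _ := fun p hp => exists_furthest hH hfin hR hbdd (p := p) (by
    obtain ⟨E, hE, z, z', h1, h2, h3, h4⟩ := hjump (p + 1000) (by omega)
    exact ⟨E, hE, z, z', h1, h2, by omega, by omega⟩)
  choose! E a b hE ha hb hab hap hpb hmax using hstep
  -- The next jump is sought 400 before the end of the current one: 200 for the required overlap and
  -- 200 lost when an index is skipped below.
  let P : ℕ → ℕ := fun k => (fun p => b p - 400)^[k] i₀
  have hP : ∀ k, P (k + 1) = b (P k) - 400 := fun k => Function.iterate_succ_apply' _ k i₀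
  have hP0 : ∀ k, i₀ ≤ P k := by
    intro k
    induction k with
    | zero => exact le_rfl
    | succ k ih => have := hpb _ ih; have := hP k; omega
  have hPb : ∀ k, b (P k) = P (k + 1) + 400 := fun k => by
    have := hpb _ (hP0 k); have := hP k; omega
  have hPP : ∀ k, P k + 1600 ≤ P (k + 1) := fun k => by
    have := hpb _ (hP0 k); have := hP k; omega
  have hPa : ∀ k, a (P k) ≤ P k := fun k => hap _ (hP0 k)
  -- A jump starting at or before `P k` would have competed for the furthest reach from `P k`, yet
  -- this one reaches beyond the winner.
  have haP : ∀ k, P k < a (P (k + 1)) := by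
    intro k
    by_contra hcon
    have h1 := hmax _ (hP0 k) _ (hE _ (hP0 (k + 1))) _ _ (ha _ (hP0 (k + 1))) (by omega)
      (hb _ (hP0 (k + 1)))
    have := hPb k
    have := hPb (k + 1)
    have := hPP (k + 1)
    omega
  have hPmono : ∀ i j, i ≤ j → P i ≤ P j := fun i j h =>
    monotone_nat_of_le_succ (fun n => by have := hPP n; omega) h
  -- An index is bad when the next jump starts hardly later. Bad indices are dropped in favour of
  -- their successors, which reach further; two consecutive ones cannot both be bad.
  let bad : ℕ → Prop := fun k => a (P (k + 1)) < a (P k) + 200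
  have hbad : ∀ k, bad k → ¬ bad (k + 1) := by
    intro k h1 h2
    have h3 : a (P (k + 1)) < a (P k) + 200 := h1
    have h4 : a (P (k + 2)) < a (P (k + 1)) + 200 := h2
    have h5 : P (k + 1) < a (P (k + 2)) := haP (k + 1)
    have := hPa k
    have := hPP k
    omega
  let skip : ℕ → ℕ := fun k => if bad k then k + 1 else k
  have hskip : ∀ k, ¬ bad (skip k) := by
    intro k
    by_cases h : bad k
    · simpa only [skip, if_pos h] using hbad k h
    · simpa only [skip, if_neg h] using h
  let g : ℕ → ℕ := fun k => (fun n => skip (n + 1))^[k] (skip 0)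
  have hg : ∀ k, g (k + 1) = skip (g k + 1) := fun k => Function.iterate_succ_apply' _ k _
  have hgood : ∀ k, ¬ bad (g k) := by
    intro k
    cases k with
    | zero => exact hskip 0
    | succ k => rw [hg]; exact hskip _
  have hg' : ∀ k, g (k + 1) = g k + 1 ∨ g (k + 1) = g k + 2 ∧ bad (g k + 1) := by
    intro k
    rw [hg]
    by_cases h : bad (g k + 1)
    · right; exact ⟨by simp only [skip, if_pos h], h⟩
    · left; simp only [skip, if_neg h]
  refine ⟨fun k => E (P (g k)), fun k => a (P (g k)), fun k => b (P (g k)),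
    fun k => hE _ (hP0 _), fun k => ha _ (hP0 _), fun k => hb _ (hP0 _),
    fun k => hab _ (hP0 _), fun k => ?_, fun k => ?_, fun k => ?_, fun k => ?_⟩
  · have h1 := hPb (g k)
    have h2 := hPa (g k + 1)
    rcases hg' k with h | ⟨h, hb⟩
    · simp only [h]; omega
    · have h3 : a (P (g k + 2)) < a (P (g k + 1)) + 200 := hb
      simp only [h]; omega
  · rcases hg' k with h | ⟨h, -⟩
    · have h1 : ¬ a (P (g k + 1)) < a (P (g k)) + 200 := hgood k
      simp only [h]; omega
    · have h1 : P (g k + 1) < a (P (g k + 2)) := haP (g k + 1)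
      have h2 := hPa (g k)
      have h3 := hPP (g k)
      simp only [h]; omega
  · have h1 := hPb (g k)
    have h2 := hPb (g (k + 1))
    have h3 := hPP (g (k + 1))
    have h4 : P (g k + 1) ≤ P (g (k + 1)) := hPmono _ _ (by rcases hg' k with h | h <;> omega)
    change b (P (g k)) + 200 ≤ b (P (g (k + 1)))
    omega
  · have h1 := hPb (g k)
    have h2 := hPP (g k + 1)
    have h6 : g k + 3 ≤ g (k + 3) := by
      have hlt : ∀ k, g k + 1 ≤ g (k + 1) := fun k => by rcases hg' k with h | h <;> omega
      exact (Nat.add_le_add_right ((Nat.add_le_add_right (hlt k) 1).trans (hlt (k + 1))) 1).trans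
        (hlt (k + 2))
    obtain ⟨n, hn⟩ : ∃ n, g (k + 3) = n + 1 := ⟨g (k + 3) - 1, by omega⟩
    have h3 : P (g k + 2) ≤ P n := hPmono _ _ (by omega)
    have h4 := haP n
    simp only [hn]
    have h5 : P (g k + 1) + 1600 ≤ P (g k + 2) := h2
    omega

/-- The overlapping jumps are thinned once more: if `E k` and `E (k + 2)` are within 12, then `E (k
+ 1)` is dropped and a link of length 12 used. A drop in one of two consecutive steps advances the
index by at least three in total, so the intervals become disjoint. With no drop, the components two
apart are more than 12 from each other and links of length 6 suffice. -/
theorem exists_jumpChain (hH : H.Connected) (hfin : ∀ v, (H.neighborSet v).Finite)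
    (hR : ∀ i j, i ≤ j → H.dist (R i) (R j) = j - i)
    (hbdd : ∀ S ⊆ H.farSet R 3, H.ConnectedOn S → ∃ n, ∀ z, H.Attached R S z → z ≤ n) {i₀ : ℕ}
    (hjump : ∀ i, i₀ ≤ i → ∃ E, H.IsComponentOf (H.farSet R 10) E ∧ ∃ z z', H.Attached R E z ∧
      H.Attached R E z' ∧ z + 1000 ≤ i ∧ i + 1000 ≤ z') : Nonempty (JumpChain H R) := by
  classical
  obtain ⟨E, a, b, hE, ha, hb, hab, hC1, hC2, hC4, hC3⟩ :=
    exists_overlapping hH hfin hR hbdd hjump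
  let close : ℕ → Prop := fun k => ∃ x ∈ E k, ∃ y ∈ E (k + 2), H.dist x y ≤ 12
  let n : ℕ → ℕ := fun t => (fun k => if close k then k + 2 else k + 1)^[t] 0
  have hn : ∀ t, n (t + 1) = if close (n t) then n t + 2 else n t + 1 :=
    fun t => Function.iterate_succ_apply' _ t 0
  have hn2 : ∀ t, close (n t) → n (t + 1) = n t + 2 := fun t h => by rw [hn, if_pos h]
  have hn1 : ∀ t, ¬ close (n t) → n (t + 1) = n t + 1 := fun t h => by rw [hn, if_neg h]
  have hlt : ∀ t, n t + 1 ≤ n (t + 1) := fun t => by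
    by_cases h : close (n t)
    · have := hn2 t h; omega
    · have := hn1 t h; omega
  have amono : ∀ i j, i ≤ j → a i ≤ a j := fun i j h =>
    monotone_nat_of_le_succ (fun n => by have := hC2 n; omega) h
  have bmono : ∀ i j, i ≤ j → b i ≤ b j := fun i j h =>
    monotone_nat_of_le_succ (fun n => by have := hC4 n; omega) h
  refine ⟨{
    E := fun t => E (n t)
    a := fun t => a (n t)
    b := fun t => b (n t)
    δ := fun t => if close (n t) then 12 else 6
    isComponent := fun t => hE _
    attached_a := fun t => ha _
    attached_b := fun t => hb _
    le_of_attached := fun t => hab _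
    a_succ := fun t => (hC2 _).trans (amono _ _ (hlt t))
    b_succ := fun t => (hC4 _).trans (bmono _ _ (hlt t))
    b_le_a := fun t => (hC3 _).trans (amono _ _
      ((Nat.add_le_add_right ((Nat.add_le_add_right (hlt t) 1).trans (hlt (t + 1))) 1).trans
        (hlt (t + 2))))
    δ_le := fun t => by split_ifs <;> omega
    sep_two := fun t => ?_
    break_or_link := fun t => ?_ }⟩
  · by_cases h : n t + 3 ≤ n (t + 2)
    · exact Or.inl ((hC3 _).trans (amono _ _ h))
    right
    have h1 : ¬ close (n t) := fun hc => by
      have := hn2 t hc; have : n (t + 1) + 1 ≤ n (t + 2) := hlt (t + 1); omega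
    have h2 : ¬ close (n (t + 1)) := fun hc => by
      have : n (t + 2) = n (t + 1) + 2 := hn2 (t + 1) hc
      have := hlt t
      omega
    have h3 : n (t + 2) = n t + 2 := by
      have h4 : n (t + 2) = n (t + 1) + 1 := hn1 (t + 1) h2
      have := hn1 t h1
      omega
    refine ⟨?_, by simp [h1], by simp [h2]⟩
    intro x hx y hy
    rw [h3] at hy
    by_contra hcon
    exact h1 ⟨x, hx, y, hy, by omega⟩
  · by_cases h : close (n t)
    · obtain ⟨x, hx, y, hy, hd⟩ := h
      right
      rw [hn2 t ⟨x, hx, y, hy, hd⟩]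
      exact ⟨x, hx, y, hy, by rw [if_pos ⟨x, hx, y, hy, hd⟩]; exact hd⟩
    · rw [hn1 t h]
      by_cases h1 : ∃ x ∈ E (n t), ∃ y ∈ E (n t + 1), H.dist x y ≤ 6
      · right
        simpa only [if_neg h] using h1
      · push Not at h1
        exact Or.inl ⟨h1, hC1 _⟩

/-- If no ball of radius `1010` far out on the geodesic ray `R` separates its start from its
end, then there are two connected sets far from each other that both follow `R`. -/
theorem exists_far_connected_sets (hH : H.Connected) (hfin : ∀ v, (H.neighborSet v).Finite)
    (hadj : ∀ n, H.Adj (R n) (R (n + 1))) (hR : ∀ i j, i ≤ j → H.dist (R i) (R j) = j - i)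
    {i₀ : ℕ} (hsep : ∀ i, i₀ ≤ i →
      ∃ l, i < l ∧ H.ReachableIn {v | 1010 < H.dist (R i) v} (R 0) (R l)) :
    ∃ A B : Set V, H.ConnectedOn A ∧ H.ConnectedOn B ∧ (∀ u ∈ A, ∀ w ∈ B, 3 < H.dist u w) ∧
      (∀ n, ∃ z, n ≤ z ∧ H.Attached R A z) ∧ ∀ n, ∃ z, n ≤ z ∧ H.Attached R B z := by
  have attached_of_mem : ∀ {A : Set V}, (∀ n, ∃ z, n ≤ z ∧ R z ∈ A) →
      ∀ n, ∃ z, n ≤ z ∧ H.Attached R A z := fun h n => by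
    obtain ⟨z, hz, hzA⟩ := h n
    exact ⟨z, hz, R z, hzA, by simp⟩
  by_cases hbdd : ∀ S ⊆ H.farSet R 3, H.ConnectedOn S → ∃ n, ∀ z, H.Attached R S z → z ≤ n
  swap
  -- A connected set far from `R` that follows `R` without bound: it and `R` itself are the two
  -- sets.
  · push Not at hbdd
    obtain ⟨S, hS, hconn, hunb⟩ := hbdd
    refine ⟨Set.range R, S, ?_, hconn, ?_, attached_of_mem fun n => ⟨n, le_rfl, n, rfl⟩,
      fun n => ?_⟩
    · rintro _ ⟨i, rfl⟩ _ ⟨j, rfl⟩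
      have hseg : JumpChain.segment R i j ⊆ Set.range R := by
        rintro _ ⟨z, -, -, rfl⟩
        exact ⟨z, rfl⟩
      exact (JumpChain.connectedOn_segment hadj i j _ ⟨i, by omega, by omega, rfl⟩ _
        ⟨j, by omega, by omega, rfl⟩).mono hseg
    · rintro _ ⟨i, rfl⟩ w hw
      rw [dist_comm]
      exact hS hw i
    · obtain ⟨z, hz, hn⟩ := hunb n
      exact ⟨z, hn.le, hz⟩
  obtain ⟨C⟩ := exists_jumpChain hH hfin hR hbdd (i₀ := i₀) fun i hi => by
    obtain ⟨l, hl, h⟩ := hsep i hi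
    exact exists_jump hH hR hl h
  have hbreak : {k | C.IsBreak k}.Infinite := by
    intro hfinite
    obtain ⟨f, hf⟩ := hfinite.bddAbove
    obtain ⟨S, hS, hconn, hunb⟩ := C.exists_unbounded_of_no_break hH (f := f + 1)
      fun k hk hb => by have := hf hb; omega
    obtain ⟨n, hn⟩ := hbdd S hS hconn
    obtain ⟨z, hz, hzS⟩ := hunb (n + 1)
    have := hn z hzS
    omega
  obtain ⟨A, B, hA, hB, hAB, hA', hB'⟩ := C.exists_routes hH hadj hR hbreak
  exact ⟨A, B, hA, hB, hAB, attached_of_mem hA', attached_of_mem hB'⟩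

end SimpleGraph

/-! ### Balls in bounded degree, and the power graph. -/

namespace SimpleGraph

universe u

variable {V : Type u} {G : SimpleGraph V}

/-- Induction on the radius through the neighbours of the centre, with `1 + Δ * (Δ + 1) ^ r ≤ (Δ +
1) ^ (r + 1)`. Reachability is required because `dist` is 0 between different components. -/
theorem exists_finset_ball {Δ : ℕ} (hdeg : ∀ v, (G.neighborSet v).encard ≤ Δ) (r : ℕ) (v : V) :
    ∃ s : Finset V, s.card ≤ (Δ + 1) ^ r ∧ ∀ w, G.Reachable v w → G.dist v w ≤ r → w ∈ s := by
  classical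
  suffices h : ∃ s : Finset V, s.card ≤ (Δ + 1) ^ r ∧
      ∀ w (p : G.Walk v w), p.length ≤ r → w ∈ s by
    obtain ⟨s, hs, h⟩ := h
    refine ⟨s, hs, fun w hw hd => ?_⟩
    obtain ⟨p, hp⟩ := hw.exists_walk_length_eq_dist
    exact h w p (by omega)
  induction r generalizing v with
  | zero =>
    refine ⟨{v}, by simp, fun w p hp => ?_⟩
    cases p with
    | nil => simp
    | cons h q => simp at hp
  | succ r ih =>
    choose s hs hmem using ih
    have hfin : (G.neighborSet v).Finite :=
      Set.finite_of_encard_le_coe (hdeg v)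
    have hcard : hfin.toFinset.card ≤ Δ := by
      have := hdeg v
      rw [hfin.encard_eq_coe_toFinset_card] at this
      exact_mod_cast this
    refine ⟨insert v (hfin.toFinset.biUnion s), ?_, fun w p hp => ?_⟩
    · have h1 : (hfin.toFinset.biUnion s).card ≤ Δ * (Δ + 1) ^ r :=
        (Finset.card_biUnion_le_card_mul _ _ _ fun w _ => hs w).trans
          (Nat.mul_le_mul_right _ hcard)
      have h2 := Finset.card_insert_le v (hfin.toFinset.biUnion s)
      have h3 : 1 ≤ (Δ + 1) ^ r := Nat.one_le_pow _ _ (by omega)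
      rw [pow_succ, mul_comm, add_mul, one_mul]
      omega
    · cases p with
      | nil => simp
      | @cons _ x _ h q =>
        rw [Walk.length_cons] at hp
        refine Finset.mem_insert_of_mem (Finset.mem_biUnion.2 ⟨x, ?_, hmem x w q (by omega)⟩)
        simpa using h

theorem finite_of_dist_le {Δ : ℕ} (hdeg : ∀ v, (G.neighborSet v).encard ≤ Δ) (o : V) (r : ℕ) :
    {v : {v // G.Reachable o v} | G.dist o v ≤ r}.Finite := by
  obtain ⟨s, -, hs⟩ := exists_finset_ball hdeg r o
  exact (s.finite_toSet.preimage Subtype.val_injective.injOn).subset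
    fun v hv => hs v.1 v.2 hv

/-- The graph on the component of `o` in which two vertices are adjacent if their distance in `G`
is bounded by `f` at their distance from `o`. -/
def powerGraph (G : SimpleGraph V) (o : V) (f : ℕ → ℕ) : SimpleGraph {v // G.Reachable o v} where
  Adj u v := u ≠ v ∧ G.dist u.1 v.1 ≤ max (f (G.dist o u)) (f (G.dist o v))
  symm := ⟨fun u v h => ⟨h.1.symm, by rw [dist_comm, max_comm]; exact h.2⟩⟩
  loopless := ⟨fun _ h => h.1 rfl⟩

theorem reachable_comp {o : V} (u v : {v // G.Reachable o v}) : G.Reachable u.1 v.1 :=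
  u.2.symm.trans v.2

theorem dist_comp_triangle {o : V} (u v w : {v // G.Reachable o v}) :
    G.dist u.1 w.1 ≤ G.dist u.1 v.1 + G.dist v.1 w.1 :=
  (reachable_comp u v).dist_triangle_left w.1

section PowerGraph

variable {o : V} {f : ℕ → ℕ}

theorem reachableIn_powerGraph (hf1 : ∀ t, 1 ≤ f t) {S : Set V} {x y : V}
    (hx : G.Reachable o x) (hy : G.Reachable o y) (h : G.ReachableIn S x y) :
    (G.powerGraph o f).ReachableIn (Subtype.val ⁻¹' S) ⟨x, hx⟩ ⟨y, hy⟩ := by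
  have hxS := h.mem_left
  have key := h.induct (P := fun v => ∃ hv : G.Reachable o v,
    (G.powerGraph o f).ReachableIn (Subtype.val ⁻¹' S) ⟨x, hx⟩ ⟨v, hv⟩) ?_
    ⟨hx, .refl hxS⟩
  · exact key.2
  · rintro u v hu hv huv ⟨huo, hr⟩
    refine ⟨huo.trans huv.reachable, hr.trans (.of_adj ⟨?_, ?_⟩ hu hv)⟩
    · simpa using huv.ne
    · change G.dist u v ≤ _
      rw [dist_eq_one_iff_adj.2 huv]
      exact (hf1 _).trans (le_max_left _ _)

theorem powerGraph_connected (hf1 : ∀ t, 1 ≤ f t) : (G.powerGraph o f).Connected := by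
  have : Nonempty {v // G.Reachable o v} := ⟨⟨o, .refl o⟩⟩
  refine ⟨fun x y => ?_⟩
  obtain ⟨p⟩ := reachable_comp x y
  obtain ⟨q, -⟩ := reachableIn_powerGraph hf1 x.2 y.2 ⟨p, fun _ _ => Set.mem_univ _⟩
  exact ⟨q⟩

theorem dist_powerGraph_le (hf1 : ∀ t, 1 ≤ f t) (x y : {v // G.Reachable o v}) :
    (G.powerGraph o f).dist x y ≤ G.dist x.1 y.1 := by
  obtain ⟨p, hp⟩ := (reachable_comp x y).exists_walk_length_eq_dist
  rw [← hp]
  have key : ∀ {u v : V} (p : G.Walk u v) (hu : G.Reachable o u) (hv : G.Reachable o v),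
      (G.powerGraph o f).dist ⟨u, hu⟩ ⟨v, hv⟩ ≤ p.length := by
    intro u v p
    induction p with
    | nil => intro hu hv; simp
    | @cons u w v h q ih =>
      intro hu hv
      have hw : G.Reachable o w := hu.trans h.reachable
      have hadj : (G.powerGraph o f).Adj ⟨u, hu⟩ ⟨w, hw⟩ := by
        refine ⟨by simpa using h.ne, ?_⟩
        change G.dist u w ≤ _
        rw [dist_eq_one_iff_adj.2 h]
        exact (hf1 _).trans (le_max_left _ _)
      have h1 := ih hw hv
      have h2 := (powerGraph_connected (G := G) (o := o) hf1).dist_triangle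
        (u := ⟨u, hu⟩) (v := ⟨w, hw⟩) (w := ⟨v, hv⟩)
      rw [dist_eq_one_iff_adj.2 hadj] at h2
      rw [Walk.length_cons]
      omega
  exact key p x.2 y.2

/-- The purpose of the bound `t / 2`: an edge of the power graph covers at most half the distance of
one of its ends from `o`, apart from steps of length 1. Hence power-graph balls are finite and, far
out, stay far out. -/
theorem norm_le_of_dist_le (hf2 : ∀ t, f t ≤ max 1 (t / 2)) {u v : {v // G.Reachable o v}}
    (h : G.dist u.1 v.1 ≤ max (f (G.dist o u)) (f (G.dist o v))) :
    G.dist o v + 1 ≤ 2 * (G.dist o u + 1) := by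
  have h1 := u.2.dist_triangle_left v.1
  have h2 := hf2 (G.dist o u)
  have h3 := hf2 (G.dist o v)
  omega

theorem finite_neighborSet_powerGraph {Δ : ℕ} (hdeg : ∀ v, (G.neighborSet v).encard ≤ Δ)
    (hf2 : ∀ t, f t ≤ max 1 (t / 2)) (u : {v // G.Reachable o v}) :
    ((G.powerGraph o f).neighborSet u).Finite := by
  refine (finite_of_dist_le hdeg o (2 * (G.dist o u + 1))).subset fun v hv => ?_
  have := norm_le_of_dist_le hf2 hv.2
  simp only [Set.mem_ofPred_eq]
  omega

/-- Each of the at most `k` steps at most doubles the distance from `o` plus one. By monotonicity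
one value of `f` therefore bounds the `G`-length of every step. -/
theorem norm_le_pow_mul (hf1 : ∀ t, 1 ≤ f t) (hf2 : ∀ t, f t ≤ max 1 (t / 2)) (hf3 : Monotone f)
    (u v : {v // G.Reachable o v}) {k : ℕ} (h : (G.powerGraph o f).dist u v ≤ k) :
    G.dist o v + 1 ≤ 2 ^ k * (G.dist o u + 1) ∧
      G.dist u.1 v.1 ≤ k * f (2 ^ k * (G.dist o u + 1)) := by
  obtain ⟨p, hp⟩ := (powerGraph_connected hf1).exists_walk_length_eq_dist u v
  rw [← hp] at h
  clear hp
  induction p generalizing k with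
  | @nil u =>
    have := Nat.one_le_two_pow (n := k)
    exact ⟨Nat.le_mul_of_pos_left _ this, by simp⟩
  | @cons u w v hadj q ih =>
    obtain ⟨k, rfl⟩ : ∃ j, k = j + 1 := ⟨k - 1, by rw [Walk.length_cons] at h; omega⟩
    rw [Walk.length_cons] at h
    obtain ⟨h1, h2⟩ := ih (k := k) (by omega)
    have h3 := norm_le_of_dist_le hf2 hadj.2
    have h4 : 2 ^ k * (G.dist o w + 1) ≤ 2 ^ (k + 1) * (G.dist o u + 1) := by
      rw [pow_succ, mul_assoc]
      exact Nat.mul_le_mul_left _ h3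
    have h5 : 2 * (G.dist o u + 1) ≤ 2 ^ (k + 1) * (G.dist o u + 1) :=
      Nat.mul_le_mul_right _ (by
        rw [pow_succ]; exact Nat.le_mul_of_pos_left _ Nat.one_le_two_pow)
    refine ⟨h1.trans h4, (dist_comp_triangle u w v).trans ?_⟩
    have h6 := hadj.2
    have h7 : max (f (G.dist o u)) (f (G.dist o w)) ≤ f (2 ^ (k + 1) * (G.dist o u + 1)) :=
      max_le (hf3 (by omega)) (hf3 (by omega))
    have h8 := Nat.mul_le_mul_left k (hf3 h4)
    rw [add_mul, one_mul]
    omega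

/-- The vertices of a shortest path of `G` between adjacent vertices of the power graph are
adjacent or equal to one of them. -/
theorem dist_le_max_of_between (u v x : {v // G.Reachable o v})
    (h : G.dist u.1 v.1 ≤ max (f (G.dist o u)) (f (G.dist o v)))
    (hx : G.dist u.1 x.1 + G.dist x.1 v.1 = G.dist u.1 v.1) :
    G.dist x.1 u.1 ≤ max (f (G.dist o x)) (f (G.dist o u)) ∨
      G.dist x.1 v.1 ≤ max (f (G.dist o x)) (f (G.dist o v)) := by
  rw [G.dist_comm (u := u.1) (v := x.1)] at hx
  omega

/-- Each edge is replaced by a shortest path of `G`. A vertex of that path is equal or adjacent in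
the power graph to one of its ends, so it is at most about twice as close to `o`. -/
theorem reachableIn_of_powerGraph (hf2 : ∀ t, f t ≤ max 1 (t / 2)) {M : ℕ}
    {x y : {v // G.Reachable o v}}
    (h : (G.powerGraph o f).ReachableIn {v | 2 * (M + 1) < G.dist o v + 1} x y) :
    G.ReachableIn {v | M < G.dist o v} x.1 y.1 := by
  have hx : 2 * (M + 1) < G.dist o x + 1 := h.mem_left
  refine h.induct (P := fun v => G.ReachableIn {v | M < G.dist o v} x.1 v.1) ?_
    (.refl (S := {v | M < G.dist o v}) (show M < G.dist o x by omega))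
  intro u v hu hv huv hr
  refine hr.trans (.of_dist_of_reachable (reachable_comp u v) fun w hw hd => ?_)
  have hu' : 2 * (M + 1) < G.dist o u + 1 := hu
  have hv' : 2 * (M + 1) < G.dist o v + 1 := hv
  have hwo : G.Reachable o w := u.2.trans hw
  change M < G.dist o w
  rcases dist_le_max_of_between u v ⟨w, hwo⟩ huv.2 hd with h1 | h1
  · have : G.dist o u + 1 ≤ 2 * (G.dist o w + 1) := norm_le_of_dist_le hf2 h1
    omega
  · have : G.dist o v + 1 ≤ 2 * (G.dist o w + 1) := norm_le_of_dist_le hf2 h1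
    omega

end PowerGraph

theorem Ray.reachable (T : G.Ray) (i j : ℕ) : G.Reachable (T.vert i) (T.vert j) := by
  obtain ⟨p, -⟩ := T.exists_walk 0 i j (by omega) (by omega)
  exact p.reachable

theorem Ray.Equivalent.reachable {T S : G.Ray} (h : T.Equivalent S) (i j : ℕ) :
    G.Reachable (T.vert i) (S.vert j) := by
  obtain ⟨N, hN⟩ := (Ray.equivalent_iff T S).1 h ∅
  obtain ⟨p, -⟩ := hN N N le_rfl le_rfl
  exact ((T.reachable i N).trans p.reachable).trans (S.reachable N j)

/-! ### Equivalence of rays tested on balls around `o`. -/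

section Radial

variable {Δ : ℕ} (hdeg : ∀ v, (G.neighborSet v).encard ≤ Δ) {o : V}
include hdeg

theorem Ray.exists_lt_dist (T : G.Ray) (hT : G.Reachable o (T.vert 0)) (M : ℕ) :
    ∃ N, ∀ k, N ≤ k → M < G.dist o (T.vert k) := by
  obtain ⟨s, -, hs⟩ := exists_finset_ball hdeg M o
  obtain ⟨N, hN⟩ := T.exists_avoids s
  refine ⟨N, fun k hk => ?_⟩
  by_contra hcon
  exact hN k hk (hs _ (hT.trans (T.reachable 0 k)) (by omega))

theorem Ray.exists_reachableIn (T : G.Ray) (hT : G.Reachable o (T.vert 0)) (M : ℕ) :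
    ∃ N, ∀ i j, N ≤ i → N ≤ j → G.ReachableIn {v | M < G.dist o v} (T.vert i) (T.vert j) := by
  obtain ⟨N, hN⟩ := T.exists_lt_dist hdeg hT M
  refine ⟨N, fun i j hi hj => ?_⟩
  obtain ⟨p, hp⟩ := T.exists_walk N i j hi hj
  refine ⟨p, fun v hv => ?_⟩
  obtain ⟨k, hk, rfl⟩ := hp v hv
  exact hN k hk

theorem Ray.Equivalent.exists_reachableIn {T S : G.Ray} (h : T.Equivalent S)
    (hT : G.Reachable o (T.vert 0)) (M : ℕ) :
    ∃ N, ∀ i j, N ≤ i → N ≤ j → G.ReachableIn {v | M < G.dist o v} (T.vert i) (S.vert j) := by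
  classical
  obtain ⟨s, -, hs⟩ := exists_finset_ball hdeg M o
  obtain ⟨N, hN⟩ := (Ray.equivalent_iff T S).1 h s
  refine ⟨N, fun i j hi hj => ?_⟩
  obtain ⟨p, hp⟩ := hN i j hi hj
  refine ⟨p, fun v hv => ?_⟩
  by_contra hcon
  exact hp v hv (hs v ((hT.trans (T.reachable 0 i)).trans (p.takeUntil v hv).reachable)
    (by simpa using hcon))

-- The bound `N'` may depend on `i`, as it does for limits along a geodesic ray; walking back along
-- `S` makes it uniform.
omit hdeg in
theorem Ray.equivalent_of_reachableIn {T S : G.Ray}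
    (h : ∀ M, ∃ N, ∀ i, N ≤ i → ∃ N', ∀ j, N' ≤ j →
      G.ReachableIn {v | M < G.dist o v} (T.vert i) (S.vert j)) : T.Equivalent S := by
  classical
  refine (Ray.equivalent_iff T S).2 fun U => ?_
  obtain ⟨N, hN⟩ := h (U.sup (G.dist o))
  obtain ⟨L, hL⟩ := S.exists_avoids U
  refine ⟨max N L, fun i j hi hj => ?_⟩
  obtain ⟨N', hN'⟩ := hN i (by omega)
  have h1 : G.ReachableIn {v | v ∉ U} (T.vert i) (S.vert (max N' L)) :=
    (hN' _ (le_max_left _ _)).mono fun v hv hvU => by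
      have h2 : U.sup (G.dist o) < G.dist o v := hv
      have h3 := Finset.le_sup (f := G.dist o) hvU
      omega
  obtain ⟨p, hp⟩ := S.exists_walk L (max N' L) j (by omega) (by omega)
  exact h1.trans ⟨p, fun v hv => by obtain ⟨k, hk, rfl⟩ := hp v hv; exact hL k hk⟩

end Radial

end SimpleGraph

/-! ### Choosing `f` so slow that balls do not separate `o` from the end. -/

namespace SimpleGraph

universe u

variable {V : Type u} {G : SimpleGraph V}

/-- There are unbounded monotone functions that grow as slowly as required. -/
theorem exists_slow_function (τ : ℕ → ℕ) :
    ∃ f : ℕ → ℕ, Monotone f ∧ (∀ t, 1 ≤ f t) ∧ (∀ t, f t ≤ max 1 (t / 2)) ∧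
      (∀ t, 2 ≤ f t → τ (f t) ≤ t) ∧ ∀ n, ∃ T, ∀ t, T ≤ t → n ≤ f t := by
  classical
  let P : ℕ → ℕ → Prop := fun t n => ∀ k ≤ n, τ k ≤ t
  -- `Nat.findGreatest` is 0 where nothing qualifies and `max` lifts this to 1, so the bound by `τ`
  -- is claimed only for values at least 2.
  refine ⟨fun t => max 1 (Nat.findGreatest (P t) (t / 2)), fun s t hst => ?_,
    fun t => le_max_left _ _, fun t => max_le_max le_rfl (Nat.findGreatest_le _),
    fun t ht => ?_, fun n => ?_⟩
  · refine max_le_max le_rfl (Nat.findGreatest_mono (fun n hn k hk => (hn k hk).trans hst) ?_)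
    exact Nat.div_le_div_right hst
  · have h1 : 2 ≤ Nat.findGreatest (P t) (t / 2) := by
      rcases le_max_iff.1 ht with h | h
      · omega
      · exact h
    have h2 : max 1 (Nat.findGreatest (P t) (t / 2)) = Nat.findGreatest (P t) (t / 2) :=
      max_eq_right (by omega)
    have h3 : P t (Nat.findGreatest (P t) (t / 2)) :=
      Nat.findGreatest_of_ne_zero rfl (by omega)
    simp only [h2]
    exact h3 _ le_rfl
  · refine ⟨max (2 * n) ((Finset.range (n + 1)).sup τ), fun t ht => ?_⟩
    refine le_max_of_le_right (Nat.le_findGreatest (by omega) fun k hk => ?_)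
    exact (Finset.le_sup (f := τ) (Finset.mem_range.2 (Nat.lt_succ_of_le hk))).trans
      ((le_max_right _ _).trans ht)

/-- In a graph of bounded degree, the balls of radius `N` in a sufficiently slowly growing power
graph do not separate a fixed vertex from a thick end. -/
theorem exists_powerGraph_escape {Δ : ℕ} (hdeg : ∀ v, (G.neighborSet v).encard ≤ Δ) (ρ : G.Ray)
    {o : V} (hρ : ∀ j, G.Reachable o (ρ.vert j))
    (hthick : ∀ n : ℕ, ∃ T : Fin n → G.Ray, (∀ i, (T i).Equivalent ρ) ∧
      ∀ i j, i ≠ j → Disjoint (T i).verts (T j).verts) (N : ℕ) :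
    ∃ f : ℕ → ℕ, Monotone f ∧ (∀ t, 1 ≤ f t) ∧ (∀ t, f t ≤ max 1 (t / 2)) ∧
      (∀ n, ∃ T, ∀ t, T ≤ t → n ≤ f t) ∧
      ∃ i₀, ∀ v : {v // G.Reachable o v}, i₀ ≤ G.dist o v →
        ∃ T : G.Ray, T.Equivalent ρ ∧ ∀ j,
          G.ReachableIn {w | ∀ hw, N < (G.powerGraph o f).dist v ⟨w, hw⟩} o (T.vert j) := by
  classical
  -- One ray more than a `G`-ball of radius `N * n` has vertices.
  choose T hT hdisj using fun n : ℕ => hthick ((Δ + 1) ^ (N * n) + 1)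
  let rad : ℕ → ℕ := fun n => Finset.univ.sup fun i => G.dist o ((T n i).vert 0)
  have hrad : ∀ n i, G.dist o ((T n i).vert 0) ≤ rad n := fun n i =>
    Finset.le_sup (f := fun i => G.dist o ((T n i).vert 0)) (Finset.mem_univ i)
  obtain ⟨f, hf3, hf1, hf2, hfτ, hfinf⟩ :=
    exists_slow_function fun n => 2 ^ N * (2 ^ N * (rad n + 1) + 1)
  refine ⟨f, hf3, hf1, hf2, hfinf, 2 ^ N * (rad 1 + 1), fun v hv => ?_⟩
  set n := f (2 ^ N * (G.dist o v + 1)) with hn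
  -- For `n ≥ 2` this is the slow growth of `f`; for `n = 1` it is the choice of the threshold for
  -- `G.dist o v`.
  have hfar : 2 ^ N * (rad n + 1) < G.dist o v + 1 := by
    by_cases h2 : 2 ≤ n
    · have h3 : 2 ^ N * (2 ^ N * (rad n + 1) + 1) ≤ 2 ^ N * (G.dist o v + 1) := hfτ _ h2
      have := Nat.le_of_mul_le_mul_left h3 (by positivity)
      omega
    · have h1 : 1 ≤ n := hf1 _
      have : n = 1 := by omega
      rw [this]
      omega
  have hball : ∀ w : {v // G.Reachable o v}, (G.powerGraph o f).dist v w ≤ N →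
      rad n < G.dist o w ∧ G.dist v.1 w.1 ≤ N * n := by
    intro w hw
    refine ⟨?_, (norm_le_pow_mul hf1 hf2 hf3 v w hw).2⟩
    have h1 := (norm_le_pow_mul hf1 hf2 hf3 w v (k := N) (by rwa [dist_comm])).1
    have h2 := lt_of_mul_lt_mul_left (hfar.trans_le h1) (by positivity)
    omega
  obtain ⟨s, hs, hsball⟩ := exists_finset_ball hdeg (N * n) v.1
  obtain ⟨i, hi⟩ : ∃ i, ∀ j, (T n i).vert j ∉ s := by
    by_contra! hcon
    choose g hg using hcon
    have hinj : Function.Injective fun i => (T n i).vert (g i) := by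
      intro i j hij
      by_contra hne
      exact Set.disjoint_left.1 (hdisj n i j hne) ⟨g i, rfl⟩ ⟨g j, hij.symm⟩
    have h1 := Finset.card_le_card_of_injOn (s := Finset.univ) (t := s)
      (fun i => (T n i).vert (g i)) (fun i _ => hg i) hinj.injOn
    rw [Finset.card_univ, Fintype.card_fin] at h1
    omega
  refine ⟨T n i, hT n i, fun j => ?_⟩
  have hreach : ∀ j, G.Reachable o ((T n i).vert j) := fun j =>
    (hρ 0).trans ((hT n i).reachable j 0).symm
  -- A shortest path from `o` to the start of the ray stays within `rad n` of `o`, closer than the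
  -- ball; the ray itself avoids the ball by choice of `i`.
  refine ReachableIn.trans (y := (T n i).vert 0)
    (.of_dist_of_reachable (hreach 0) fun w _ hd => ?_) ?_
  · intro hw
    by_contra hcon
    have h1 : rad n < G.dist o w := (hball ⟨w, hw⟩ (by omega)).1
    have h2 := hrad n i
    omega
  · obtain ⟨p, hp⟩ := (T n i).exists_walk 0 0 j le_rfl (by omega)
    refine ⟨p, fun w hw hwo => ?_⟩
    obtain ⟨k, -, rfl⟩ := hp w hw
    by_contra hcon
    exact hi k (hsball _ (v.2.symm.trans hwo) (hball ⟨_, hwo⟩ (by omega)).2)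

/-! ### Passing between rays of `G` and connected sets of the power graph. -/

section Routes

variable {Δ : ℕ} (hdeg : ∀ v, (G.neighborSet v).encard ≤ Δ) (ρ : G.Ray) {o : V}
  (hρ : ∀ j, G.Reachable o (ρ.vert j)) {f : ℕ → ℕ} (hf1 : ∀ t, 1 ≤ f t) (hf2 : ∀ t, f t ≤ max 1 (t / 2))
include hdeg hf1 hf2

/-- The power graph has a geodesic ray that converges to the end of a given ray. -/
theorem exists_geodesic_powerGraph :
    ∃ R : ℕ → {v // G.Reachable o v}, R 0 = ⟨o, .refl o⟩ ∧
      (∀ n, (G.powerGraph o f).Adj (R n) (R (n + 1))) ∧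
      (∀ n, (G.powerGraph o f).dist (R 0) (R n) = n) ∧
      ∀ M, ∃ N, ∀ i, N ≤ i → ∃ N', ∀ j, N' ≤ j →
        (G.powerGraph o f).ReachableIn {v | M < G.dist o v} (R i)
          ⟨ρ.vert j, hρ j⟩ := by
  set H := G.powerGraph o f with hHdef
  have hH : H.Connected := powerGraph_connected hf1
  let ρ' : ℕ → {v // G.Reachable o v} := fun j => ⟨ρ.vert j, hρ j⟩
  have hinj : Function.Injective ρ' := fun i j hij => ρ.inj (congrArg Subtype.val hij)
  obtain ⟨R, h0, hadj, hd, hinf⟩ := exists_geodesic_ray hH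
    (finite_neighborSet_powerGraph hdeg hf2) ⟨o, .refl o⟩ (Set.infinite_range_of_injective hinj)
  refine ⟨R, h0, hadj, by simpa only [h0] using hd, fun M => ⟨M + 1, fun i hi => ?_⟩⟩
  obtain ⟨N, hN⟩ := ρ.exists_reachableIn hdeg (hρ 0) M
  obtain ⟨x, ⟨⟨n, rfl⟩, hx⟩, hnN⟩ : ∃ x, x ∈ {x ∈ Set.range ρ' | H.dist ⟨o, .refl o⟩ x =
      i + H.dist (R i) x} ∧ x ∉ ρ' '' Set.Iio N := by
    by_contra! hcon
    exact hinf i (((Set.finite_Iio N).image ρ').subset hcon)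
  have hnN' : N ≤ n := by
    by_contra hlt
    exact hnN ⟨n, by simpa using hlt, rfl⟩
  refine ⟨N, fun j hj => (ReachableIn.of_dist hH fun v hv => ?_).trans
    (reachableIn_powerGraph hf1 (hρ n) (hρ j) (hN n j hnN' hj))⟩
  -- `R i` and `v` lie in this order on a power-graph geodesic from `o` to `ρ' n`, so `v` has
  -- distance at least `i > M` from `o` there, and no less in `G`.
  change M < G.dist o v
  have h1 := dist_powerGraph_le hf1 ⟨o, .refl o⟩ v
  have h2 : H.dist ⟨o, .refl o⟩ (ρ' n) ≤ H.dist ⟨o, .refl o⟩ v + H.dist v (ρ' n) :=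
    hH.dist_triangle
  change H.dist _ v ≤ G.dist o v at h1
  change H.dist (R i) v + H.dist v (ρ' n) = H.dist (R i) (ρ' n) at hv
  omega

omit hdeg hf1 hf2 in
/-- The vertices on shortest paths of `G` between equal or adjacent vertices of `A`. -/
theorem exists_connectedOn_expansion {A : Set {v // G.Reachable o v}}
    (hA : (G.powerGraph o f).ConnectedOn A) :
    ∃ A' : Set V, G.ConnectedOn A' ∧ (∀ u ∈ A, u.1 ∈ A') ∧ ∀ x ∈ A', G.Reachable o x ∧
      ∃ u ∈ A, G.dist x u.1 ≤ max (f (G.dist o x)) (f (G.dist o u)) := by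
  let A' : Set V := {x | G.Reachable o x ∧ ∃ u ∈ A, ∃ v ∈ A,
    G.dist u.1 v.1 ≤ max (f (G.dist o u)) (f (G.dist o v)) ∧
    G.dist u.1 x + G.dist x v.1 = G.dist u.1 v.1}
  have hAA' : ∀ u ∈ A, u.1 ∈ A' := fun u hu => ⟨u.2, u, hu, u, hu, by simp, by simp⟩
  have hbetween : ∀ x ∈ A', ∃ u ∈ A, G.ReachableIn A' u.1 x := by
    rintro x ⟨hx, u, hu, v, hv, huv, hxuv⟩
    refine ⟨u, hu, .of_dist_of_reachable (u.2.symm.trans hx) fun w hw hd => ?_⟩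
    have hwo := u.2.trans hw
    refine ⟨hwo, u, hu, v, hv, huv, ?_⟩
    have h1 := dist_comp_triangle ⟨w, hwo⟩ ⟨x, hx⟩ v
    have h2 := dist_comp_triangle u ⟨w, hwo⟩ v
    simp only at h1 h2
    omega
  have hlift : ∀ u ∈ A, ∀ v ∈ A, G.ReachableIn A' u.1 v.1 := by
    intro u hu v hv
    refine (hA u hu v hv).induct (P := fun v => G.ReachableIn A' u.1 v.1) ?_ (.refl (hAA' u hu))
    intro v w hv hw hvw hr
    exact hr.trans (.of_dist_of_reachable (reachable_comp v w) fun x hx hd =>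
      ⟨v.2.trans hx, v, hv, w, hw, hvw.2, hd⟩)
  refine ⟨A', fun x hx y hy => ?_, hAA', ?_⟩
  · obtain ⟨u, hu, hux⟩ := hbetween x hx
    obtain ⟨v, hv, hvy⟩ := hbetween y hy
    exact (hux.symm.trans (hlift u hu v hv)).trans hvy
  · rintro x ⟨hx, u, hu, v, hv, huv, hxuv⟩
    refine ⟨hx, ?_⟩
    rcases dist_le_max_of_between u v ⟨x, hx⟩ huv hxuv with h | h
    · exact ⟨u, hu, h⟩
    · exact ⟨v, hv, h⟩

/-- A connected set that follows a sequence converging to the end of `ρ` contains a ray of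
that end. -/
theorem exists_ray_of_connectedOn (hf3 : Monotone f)
    {R : ℕ → {v // G.Reachable o v}}
    (hd : ∀ n, (G.powerGraph o f).dist (R 0) (R n) = n)
    (hlim : ∀ M, ∃ N, ∀ i, N ≤ i → ∃ N', ∀ j, N' ≤ j →
        (G.powerGraph o f).ReachableIn {v | M < G.dist o v} (R i)
          ⟨ρ.vert j, hρ j⟩)
    {A : Set {v // G.Reachable o v}}
    (hatt : ∀ n, ∃ z, n ≤ z ∧ (G.powerGraph o f).Attached R A z)
    {A' : Set V} (hA' : G.ConnectedOn A') (hAA' : ∀ u ∈ A, u.1 ∈ A')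
    (hreach : ∀ x ∈ A', G.Reachable o x) :
    ∃ T : G.Ray, (∀ i, T.vert i ∈ A') ∧ T.Equivalent ρ := by
  classical
  set H := G.powerGraph o f with hHdef
  have hH : H.Connected := powerGraph_connected hf1
  -- A geodesic ray of the induced graph aimed at these points will do: there are infinitely many of
  -- them because `R` is geodesic and the attachments are unbounded.
  let X : Set A' := {x | ∃ u ∈ A, u.1 = x.1 ∧ ∃ z, H.dist u (R z) ≤ 11}
  have hX : X.Infinite := by
    intro hfin
    let b : A' → ℕ := fun x => H.dist (R 0) ⟨x.1, hreach x.1 x.2⟩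
    obtain ⟨z, hz, u, hu, hduz⟩ := hatt (hfin.toFinset.sup b + 12)
    have h1 : b ⟨u.1, hAA' u hu⟩ ≤ hfin.toFinset.sup b :=
      Finset.le_sup (f := b) (hfin.mem_toFinset.2 ⟨u, hu, rfl, z, hduz⟩)
    have h2 : H.dist (R 0) (R z) ≤ H.dist (R 0) u + H.dist u (R z) := hH.dist_triangle
    rw [hd] at h2
    change H.dist (R 0) u ≤ _ at h1
    omega
  obtain ⟨x₀, -⟩ := hX.nonempty
  set K := G.induce A' with hKdef
  have hK : K.Connected := by
    have : Nonempty A' := ⟨x₀⟩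
    refine ⟨fun x y => ?_⟩
    obtain ⟨p, hp⟩ := hA' x.1 x.2 y.1 y.2
    exact (p.induce A' hp).reachable
  have hKfin : ∀ v, (K.neighborSet v).Finite := fun v =>
    ((Set.finite_of_encard_le_coe (hdeg v.1)).preimage Subtype.val_injective.injOn).subset
      fun w hw => hw
  obtain ⟨Y, -, hYadj, hYd, hYinf⟩ := exists_geodesic_ray hK hKfin x₀ hX
  have hYinj : Function.Injective Y := fun i j hij => by
    have h1 := hYd i
    rw [hij, hYd] at h1
    exact h1.symm
  let T : G.Ray := ⟨fun n => (Y n).1, Subtype.val_injective.comp hYinj, hYadj⟩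
  have hballfin : ∀ M, {x : A' | G.dist o x ≤ M}.Finite := fun M => by
    obtain ⟨s, -, hs⟩ := exists_finset_ball hdeg M o
    exact (s.finite_toSet.preimage Subtype.val_injective.injOn).subset
      fun v hv => hs v.1 (hreach v.1 v.2) hv
  refine ⟨T, fun i => (Y i).2, Ray.equivalent_of_reachableIn (o := o) fun M => ?_⟩
  let L := (hballfin M).toFinset.sup (K.dist x₀)
  refine ⟨L + 1, fun i hi => ?_⟩
  obtain ⟨N, hN⟩ := hlim (2 * (M + 1))
  -- Eleven power-graph steps change the distance from `o`, plus one, by a factor of at most `2 ^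
  -- 11`. The first term keeps the path from `u` to `R z` far from `o`, the second forces `N ≤ z`.
  let bound := max (2 ^ 11 * (2 * (M + 1) + 1))
    ((Finset.range N).sup fun z => 2 ^ 11 * (G.dist o (R z) + 1))
  obtain ⟨x, ⟨⟨u, hu, hux, z, hz⟩, hx⟩, hxb⟩ : ∃ x, x ∈ {x ∈ X | K.dist x₀ x =
      i + K.dist (Y i) x} ∧ x ∉ {x : A' | G.dist o x ≤ bound} := by
    by_contra! hcon
    exact hYinf i ((hballfin bound).subset hcon)
  have hub : bound < G.dist o u := by
    rw [hux]; simpa using hxb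
  have hzN : N ≤ z := by
    by_contra hlt
    have h1 := (norm_le_pow_mul hf1 hf2 hf3 (R z) u (k := 11) (by rwa [dist_comm])).1
    have h2 := Finset.le_sup (f := fun z => 2 ^ 11 * (G.dist o (R z) + 1))
      (Finset.mem_range.2 (not_le.1 hlt))
    have h3 : _ ≤ bound := le_max_right _ _
    have h4 := h2.trans h3
    omega
  obtain ⟨N', hN'⟩ := hN z hzN
  refine ⟨N', fun j hj => ?_⟩
  have hYx : G.ReachableIn {v | M < G.dist o v} (T.vert i) x.1 := by
    obtain ⟨p, hp⟩ := ReachableIn.of_dist (S := {v : A' | M < G.dist o v}) hK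
      (x := Y i) (y := x) fun v hv => by
        by_contra hcon
        have h1 : K.dist x₀ v ≤ L := Finset.le_sup (f := K.dist x₀)
          ((hballfin M).mem_toFinset.2 (by simpa using hcon))
        have h2 : K.dist x₀ x ≤ K.dist x₀ v + K.dist v x := hK.dist_triangle
        omega
    refine ⟨p.map (Embedding.induce (G := G) A').toHom, fun v hv => ?_⟩
    have hv := (Walk.support_map (Embedding.induce (G := G) A').toHom p) ▸ hv
    rw [List.mem_map] at hv
    obtain ⟨w, hw, rfl⟩ := hv
    exact hp w hw
  have hmono : ∀ v : {v // G.Reachable o v}, 2 * (M + 1) < G.dist o v →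
      2 * (M + 1) < G.dist o v + 1 := fun v hv => by omega
  have huR : H.ReachableIn {v | 2 * (M + 1) < G.dist o v + 1} u (R z) := by
    refine .of_dist hH fun v hv => ?_
    change 2 * (M + 1) < G.dist o v + 1
    have h1 := (norm_le_pow_mul hf1 hf2 hf3 v u (k := 11) (by
      rw [dist_comm]
      change H.dist u v ≤ 11
      omega)).1
    have h3 : _ ≤ bound := le_max_left _ _
    omega
  have h4 := reachableIn_of_powerGraph hf2 (huR.trans ((hN' j hj).mono hmono))
  rw [hux] at h4
  exact hYx.trans h4

end Routes

/-- A thick end of a graph of bounded degree contains two rays that diverge. -/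
theorem exists_diverging_rays {Δ : ℕ} (hdeg : ∀ v, (G.neighborSet v).encard ≤ Δ) (ρ : G.Ray)
    (hthick : ∀ n : ℕ, ∃ T : Fin n → G.Ray, (∀ i, (T i).Equivalent ρ) ∧
      ∀ i j, i ≠ j → Disjoint (T i).verts (T j).verts) :
    ∃ P Q : G.Ray, P.Equivalent ρ ∧ Q.Equivalent ρ ∧ (∀ i j, P.vert i ≠ Q.vert j) ∧
      ∀ n, ∃ I, ∀ i j, I ≤ i → I ≤ j → n < G.dist (P.vert i) (Q.vert j) := by
  obtain ⟨o, hρ⟩ : ∃ o, ∀ j, G.Reachable o (ρ.vert j) := ⟨ρ.vert 0, ρ.reachable 0⟩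
  obtain ⟨f, hf3, hf1, hf2, hfinf, i₀, hesc⟩ := exists_powerGraph_escape hdeg ρ hρ hthick 1010
  obtain ⟨R, h0, hadj, hd, hlim⟩ := exists_geodesic_powerGraph hdeg ρ hρ hf1 hf2
  set H := G.powerGraph o f with hHdef
  have hH : H.Connected := powerGraph_connected hf1
  have hfin := finite_neighborSet_powerGraph (o := o) hdeg hf2
  have hR : ∀ i j, i ≤ j → H.dist (R i) (R j) = j - i := fun i j => dist_geodesic hH hadj hd
  have hnorm : ∀ i, i ≤ G.dist o (R i) := fun i => by
    have h1 := dist_powerGraph_le hf1 (R 0) (R i)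
    rw [← hHdef, hd, h0] at h1
    exact h1
  have hsep : ∀ i, i₀ ≤ i →
      ∃ l, i < l ∧ H.ReachableIn {v | 1010 < H.dist (R i) v} (R 0) (R l) := by
    intro i hi
    obtain ⟨T, hT, hTesc⟩ := hesc (R i) (hi.trans (hnorm i))
    let F := finite_dist_le hH hfin (R i) 1010
    -- Beyond `G`-distance `M` from `o` the ball around `R i` is left behind, so the escaping ray
    -- can be joined to `ρ`, and `ρ` to a late `R l`, out there.
    let M := F.toFinset.sup fun v => G.dist o v.1
    have hsub : {v : {v // G.Reachable o v} | M < G.dist o v} ⊆ {v | 1010 < H.dist (R i) v} := by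
      intro v hv
      by_contra hcon
      have h1 : G.dist o v ≤ M := Finset.le_sup (f := fun v : {v // G.Reachable o v} =>
        G.dist o v.1) (F.mem_toFinset.2 (by simpa using hcon))
      have h2 : M < G.dist o v := hv
      omega
    have hTo : ∀ j, G.Reachable o (T.vert j) := fun j => (hρ 0).trans (hT.reachable j 0).symm
    obtain ⟨N₁, hN₁⟩ := hT.exists_reachableIn hdeg (hTo 0) M
    obtain ⟨N₂, hN₂⟩ := hlim M
    obtain ⟨N₃, hN₃⟩ := hN₂ (max N₂ (i + 1)) (le_max_left _ _)
    refine ⟨max N₂ (i + 1), by omega, ?_⟩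
    have h1 := (reachableIn_powerGraph hf1 (.refl o) (hTo N₁) (hTesc N₁)).mono
      (T := {v | 1010 < H.dist (R i) v})
        fun v (hv : ∀ hw, 1010 < H.dist (R i) ⟨v.1, hw⟩) => hv v.2
    have h2 := (reachableIn_powerGraph hf1 (hTo N₁) (hρ (max N₁ N₃))
      (hN₁ N₁ (max N₁ N₃) le_rfl (le_max_left _ _))).mono hsub
    have h3 := (hN₃ (max N₁ N₃) (le_max_right _ _)).mono hsub
    rw [h0]
    exact (h1.trans h2).trans h3.symm
  obtain ⟨A, B, hA, hB, hAB, hattA, hattB⟩ := exists_far_connected_sets hH hfin hadj hR hsep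
  obtain ⟨A', hA', hAA', hA'n⟩ := exists_connectedOn_expansion hA
  obtain ⟨B', hB', hBB', hB'n⟩ := exists_connectedOn_expansion hB
  obtain ⟨P, hPA, hP⟩ := exists_ray_of_connectedOn hdeg ρ hρ hf1 hf2 hf3 hd hlim hattA hA' hAA'
    fun x hx => (hA'n x hx).1
  obtain ⟨Q, hQB, hQ⟩ := exists_ray_of_connectedOn hdeg ρ hρ hf1 hf2 hf3 hd hlim hattB hB' hBB'
    fun x hx => (hB'n x hx).1
  have hdist : ∀ u v : {v // G.Reachable o v},
      G.dist u.1 v.1 ≤ max (f (G.dist o u)) (f (G.dist o v)) → H.dist u v ≤ 1 := by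
    intro u v h
    by_cases huv : u = v
    · simp [huv]
    · exact (dist_eq_one_iff_adj.2 (show H.Adj u v from ⟨huv, h⟩)).le
  -- Otherwise `P.vert i` and `Q.vert j` are equal or adjacent in `H`, and each is within one step
  -- of `A` or `B`: in total a distance of at most 3 between the two sets.
  have hfar : ∀ i j, f (G.dist o (P.vert i)) < G.dist (P.vert i) (Q.vert j) := by
    intro i j
    by_contra hcon
    obtain ⟨hx, u, hu, hux⟩ := hA'n _ (hPA i)
    obtain ⟨hy, v, hv, hvy⟩ := hB'n _ (hQB j)
    have h1 := hdist ⟨_, hx⟩ u hux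
    have h2 := hdist ⟨_, hy⟩ v hvy
    have h3 := hdist ⟨_, hx⟩ ⟨_, hy⟩ ((not_lt.1 hcon).trans (le_max_left _ _))
    have h4 := hAB u hu v hv
    have h5 := hH.dist_triangle (u := u) (v := ⟨_, hx⟩) (w := v)
    have h6 := hH.dist_triangle (u := ⟨_, hx⟩) (v := ⟨_, hy⟩) (w := v)
    rw [dist_comm] at h1
    omega
  refine ⟨P, Q, hP, hQ, fun i j hij => ?_, fun n => ?_⟩
  · have h1 := hfar i j
    rw [hij] at h1
    simp at h1
  · obtain ⟨t, ht⟩ := hfinf n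
    obtain ⟨I, hI⟩ := P.exists_lt_dist hdeg (o := o) ((hρ 0).trans (hP.reachable 0 0).symm) t
    exact ⟨I, fun i j hi _ => (ht _ (hI i hi).le).trans_lt (hfar i j)⟩

end SimpleGraph

/-! ### From two diverging rays to a double ray. -/

namespace SimpleGraph

universe u

variable {V : Type u} {G : SimpleGraph V}

/-- Two disjoint rays in the same component have tails that form the two ends of a double ray. -/
theorem exists_doubleRay (P Q : G.Ray) (hPQ : ∀ i j, P.vert i ≠ Q.vert j)
    (hreach : G.Reachable (P.vert 0) (Q.vert 0)) :
    ∃ (D : G.DoubleRay) (i j L : ℕ), (∀ n : ℕ, D.vert (-n) = P.vert (i + n)) ∧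
      ∀ n : ℕ, D.vert (L + n) = Q.vert (j + n) := by
  classical
  -- A shortest path between a closest pair of vertices of the two rays meets them only in its ends,
  -- since any other common vertex would give a closer pair.
  have hex : ∃ d, ∃ i j, G.dist (P.vert i) (Q.vert j) = d := ⟨_, 0, 0, rfl⟩
  obtain ⟨i, j, hL⟩ := Nat.find_spec hex
  have hmin : ∀ i' j', Nat.find hex ≤ G.dist (P.vert i') (Q.vert j') :=
    fun i' j' => Nat.find_min' hex ⟨i', j', rfl⟩
  generalize Nat.find hex = L at hL hmin
  have hij : G.Reachable (P.vert i) (Q.vert j) :=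
    ((P.reachable i 0).trans hreach).trans (Q.reachable 0 j)
  obtain ⟨p, hp⟩ := hij.exists_walk_length_eq_dist
  have hpath := p.isPath_of_length_eq_dist hp
  rw [hL] at hp
  have hL0 : 0 < L := by
    rw [← hL]
    exact hij.pos_dist_of_ne (hPQ i j)
  have hintP : ∀ k i', 0 < k → k ≤ L → p.getVert k ≠ P.vert i' := by
    intro k i' h0 hk h
    have h1 := dist_le (p.drop k)
    rw [Walk.drop_length, h] at h1
    have := hmin i' j
    omega
  have hintQ : ∀ k j', k < L → p.getVert k ≠ Q.vert j' := by
    intro k j' hk h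
    have h1 := dist_le (p.take k)
    rw [Walk.take_length, h] at h1
    have := hmin i j'
    omega
  have hinj : ∀ k l, k ≤ L → l ≤ L → p.getVert k = p.getVert l → k = l := fun k l hk hl h =>
    hpath.getVert_injOn (by simpa [hp] using hk) (by simpa [hp] using hl) h
  have hend : p.getVert L = Q.vert j := by rw [← hp, Walk.getVert_length]
  let v : ℤ → V := fun n => if n ≤ 0 then P.vert (i + (-n).toNat) else
    if n < L then p.getVert n.toNat else Q.vert (j + (n - L).toNat)
  have hvP : ∀ n : ℕ, v (-n) = P.vert (i + n) := fun n => by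
    simp only [v]
    rw [if_pos (by omega)]
    simp
  have hvp : ∀ n : ℕ, n ≤ L → v n = p.getVert n := fun n hn => by
    simp only [v]
    split_ifs with h1 h2
    · obtain rfl : n = 0 := by omega
      simp
    · simp
    · obtain rfl : n = L := by omega
      simp [hend]
  have hvQ : ∀ n : ℕ, v (L + n) = Q.vert (j + n) := fun n => by
    simp only [v]
    rw [if_neg (by omega), if_neg (by omega)]
    simp
  have hcases : ∀ n : ℤ, (∃ a : ℕ, n = -a) ∨ (∃ k : ℕ, 0 < k ∧ k < L ∧ n = k) ∨
      ∃ b : ℕ, n = L + b := by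
    intro n
    by_cases h1 : n ≤ 0
    · exact Or.inl ⟨(-n).toNat, by omega⟩
    by_cases h2 : n < L
    · exact Or.inr (Or.inl ⟨n.toNat, by omega, by omega, by omega⟩)
    · exact Or.inr (Or.inr ⟨(n - L).toNat, by omega⟩)
  refine ⟨⟨v, fun m n hmn => ?_, fun n => ?_⟩, i, j, L, hvP, hvQ⟩
  · rcases hcases m with ⟨a, rfl⟩ | ⟨k, hk0, hk, rfl⟩ | ⟨b, rfl⟩ <;>
      rcases hcases n with ⟨a', rfl⟩ | ⟨k', hk0', hk', rfl⟩ | ⟨b', rfl⟩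
    · rw [hvP, hvP] at hmn
      have := P.inj hmn
      omega
    · rw [hvP, hvp _ hk'.le] at hmn
      exact absurd hmn.symm (hintP _ _ hk0' hk'.le)
    · rw [hvP, hvQ] at hmn
      exact absurd hmn (hPQ _ _)
    · rw [hvP, hvp _ hk.le] at hmn
      exact absurd hmn (hintP _ _ hk0 hk.le)
    · rw [hvp _ hk.le, hvp _ hk'.le] at hmn
      rw [hinj _ _ hk.le hk'.le hmn]
    · rw [hvp _ hk.le, hvQ] at hmn
      exact absurd hmn (hintQ _ _ hk)
    · rw [hvP, hvQ] at hmn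
      exact absurd hmn.symm (hPQ _ _)
    · rw [hvQ, hvp _ hk'.le] at hmn
      exact absurd hmn.symm (hintQ _ _ hk')
    · rw [hvQ, hvQ] at hmn
      have := Q.inj hmn
      omega
  · rcases lt_or_ge n 0 with h | h
    · obtain ⟨a, rfl⟩ : ∃ a : ℕ, n = -((a + 1 : ℕ) : ℤ) := ⟨(-n - 1).toNat, by omega⟩
      rw [hvP, show -((a + 1 : ℕ) : ℤ) + 1 = -(a : ℤ) by push_cast; ring, hvP]
      exact (P.adj (i + a)).symm
    rcases lt_or_ge n L with h' | h'
    · obtain ⟨k, rfl⟩ : ∃ k : ℕ, n = k := ⟨n.toNat, by omega⟩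
      have h1 := hvp (k + 1) (by omega)
      push_cast at h1
      rw [hvp k (by omega), h1]
      exact p.adj_getVert_succ (by omega)
    · obtain ⟨b, rfl⟩ : ∃ b : ℕ, n = L + b := ⟨(n - L).toNat, by omega⟩
      have h1 := hvQ (b + 1)
      push_cast at h1
      rw [hvQ, add_assoc, h1]
      exact Q.adj (j + b)

theorem Ray.equivalent_of_eventually_eq {S T : G.Ray} {a b : ℕ}
    (h : ∀ n, S.vert (a + n) = T.vert (b + n)) : S.Equivalent T := by
  refine (Ray.equivalent_iff S T).2 fun U => ?_
  obtain ⟨N, hN⟩ := S.exists_avoids U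
  obtain ⟨M, hM⟩ := T.exists_avoids U
  refine ⟨max N M, fun i j hi hj => ?_⟩
  obtain ⟨p, hp⟩ := S.exists_walk N i (a + (N + M)) (by omega) (by omega)
  obtain ⟨q, hq⟩ := T.exists_walk M (b + (N + M)) j (by omega) (by omega)
  have h1 : G.ReachableIn {v | v ∉ U} (S.vert i) (S.vert (a + (N + M))) :=
    ⟨p, fun v hv => by obtain ⟨k, hk, rfl⟩ := hp v hv; exact hN k hk⟩
  have h2 : G.ReachableIn {v | v ∉ U} (T.vert (b + (N + M))) (T.vert j) :=
    ⟨q, fun v hv => by obtain ⟨k, hk, rfl⟩ := hq v hv; exact hM k hk⟩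
  rw [h] at h1
  exact h1.trans h2

/-- The tail of a ray that starts at a given index. -/
def Ray.drop (T : G.Ray) (k : ℕ) : G.Ray where
  vert n := T.vert (k + n)
  inj _ _ h := Nat.add_left_cancel (T.inj h)
  adj n := T.adj (k + n)

theorem Ray.Diverge.symm {S T : G.Ray} (h : S.Diverge T) : T.Diverge S := by
  intro n
  obtain ⟨S', T', hS, hT, hn⟩ := h n
  refine ⟨T', S', hT, hS, hn.trans_le ?_⟩
  refine le_iInf₂ fun u hu => le_iInf₂ fun w hw => ?_
  rw [edist_comm]
  exact iInf₂_le_of_le w hw (iInf₂_le u hu)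

theorem Ray.diverge_of_eventually_eq {P Q S T : G.Ray}
    (h : ∀ n, ∃ I, ∀ i j, I ≤ i → I ≤ j → n < G.dist (P.vert i) (Q.vert j)) {a b a' b' : ℕ}
    (hS : ∀ n, S.vert (a + n) = P.vert (b + n)) (hT : ∀ n, T.vert (a' + n) = Q.vert (b' + n)) :
    S.Diverge T := by
  intro n
  obtain ⟨I, hI⟩ := h n
  refine ⟨S.drop (a + I), T.drop (a' + I), ⟨_, fun _ => rfl⟩, ⟨_, fun _ => rfl⟩, ?_⟩
  have key : ((n + 1 : ℕ) : ℕ∞) ≤ G.setEDist (S.drop (a + I)).verts (T.drop (a' + I)).verts := by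
    refine le_iInf₂ fun u hu => le_iInf₂ fun w hw => ?_
    obtain ⟨i, rfl⟩ := hu
    obtain ⟨j, rfl⟩ := hw
    change _ ≤ G.edist (S.vert (a + I + i)) (T.vert (a' + I + j))
    rw [add_assoc, add_assoc, hS, hT]
    have h1 := hI (b + (I + i)) (b' + (I + j)) (by omega) (by omega)
    -- A nonzero `dist` certifies reachability, so `edist` is this finite value and not `⊤`.
    have h2 : G.Reachable (P.vert (b + (I + i))) (Q.vert (b' + (I + j))) :=
      Reachable.of_dist_ne_zero (by omega)
    rw [← h2.coe_dist_eq_edist]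
    exact_mod_cast h1
  exact lt_of_lt_of_le (by exact_mod_cast Nat.lt_succ_self n) key

end SimpleGraph

theorem theorem4p1 {V : Type*} (G : SimpleGraph V)
    (hdeg : ∃ Δ : ℕ, ∀ v : V, (G.neighborSet v).encard ≤ Δ)
    (ε : G.RayEnd) (hε : ε.IsThick) :
    ∃ D : G.DoubleRay, D.LiesIn ε ∧ D.Diverges := by
  obtain ⟨Δ, hdeg⟩ := hdeg
  obtain ⟨ρ, rfl⟩ : ∃ ρ : G.Ray, ρ.toEnd = ε := Quotient.exists_rep ε
  have htoEnd : ∀ {S T : G.Ray}, S.toEnd = T.toEnd ↔ S.Equivalent T := fun {S T} =>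
    Quotient.eq (r := SimpleGraph.Ray.setoid G)
  obtain ⟨P, Q, hP, hQ, hPQ, hfar⟩ := SimpleGraph.exists_diverging_rays hdeg ρ fun n => by
    obtain ⟨T, hT, hdisj⟩ := hε n
    exact ⟨T, fun i => htoEnd.1 (hT i), hdisj⟩
  have hequiv := SimpleGraph.Ray.equivalent_equivalence G
  obtain ⟨D, i, j, L, hDP, hDQ⟩ := SimpleGraph.exists_doubleRay P Q hPQ
    ((hequiv.trans hP (hequiv.symm hQ)).reachable 0 0)
  have hforward : ∀ (T : G.Ray) (k : ℤ), (∀ n : ℕ, T.vert n = D.vert (k + n)) →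
      ∃ a b, ∀ n, T.vert (a + n) = Q.vert (b + n) := by
    intro T k hT
    refine ⟨(L - k).toNat, j + (k - L).toNat, fun n => ?_⟩
    rw [hT, add_assoc, ← hDQ]
    congr 1
    omega
  have hbackward : ∀ (T : G.Ray) (k : ℤ), (∀ n : ℕ, T.vert n = D.vert (k - n)) →
      ∃ a b, ∀ n, T.vert (a + n) = P.vert (b + n) := by
    intro T k hT
    refine ⟨k.toNat, i + (-k).toNat, fun n => ?_⟩
    rw [hT, add_assoc, ← hDP]
    congr 1
    omega
  refine ⟨D, fun T hT => htoEnd.2 ?_, fun T T' hT hT' hdisj => ?_⟩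
  · rcases hT with ⟨k, hT⟩ | ⟨k, hT⟩
    · obtain ⟨a, b, h⟩ := hforward T k hT
      exact hequiv.trans (SimpleGraph.Ray.equivalent_of_eventually_eq h) hQ
    · obtain ⟨a, b, h⟩ := hbackward T k hT
      exact hequiv.trans (SimpleGraph.Ray.equivalent_of_eventually_eq h) hP
  · rcases hT with ⟨k, hT⟩ | ⟨k, hT⟩ <;> rcases hT' with ⟨k', hT'⟩ | ⟨k', hT'⟩
    -- Two tails in the same direction share a vertex, so only opposite tails have to diverge.
    · refine absurd ?_ (Set.disjoint_left.1 hdisj ⟨(k' - k).toNat, rfl⟩)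
      refine ⟨(k - k').toNat, ?_⟩
      rw [hT, hT']
      congr 1
      omega
    · obtain ⟨a, b, h⟩ := hforward T k hT
      obtain ⟨a', b', h'⟩ := hbackward T' k' hT'
      exact (SimpleGraph.Ray.diverge_of_eventually_eq hfar h' h).symm
    · obtain ⟨a, b, h⟩ := hbackward T k hT
      obtain ⟨a', b', h'⟩ := hforward T' k' hT'
      exact SimpleGraph.Ray.diverge_of_eventually_eq hfar h h'
    · refine absurd ?_ (Set.disjoint_left.1 hdisj ⟨(k - k').toNat, rfl⟩)
      refine ⟨(k' - k).toNat, ?_⟩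
      rw [hT, hT']
      congr 1
      omega
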